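/- Let $(M,\eta)$ be an $m$-dimensional pseudo-Riemannian manifold and $(\Sigma,g)$ an $n$-dimensional (immersed) submanifold whose induced metric $g$ is nondegenerate. Let $x^1,\dots,x^m$ be local coordinates on $M$, regarded also as local functions on $\Sigma$, and $u^1,\dots,u^n$ local coordinates on $\Sigma$, with $\partial_a=\partial/\partial u^a$. Let $\{\cdot,\dots,\cdot\}$ be an $(N+1)$-linear bracket $C^\infty(\Sigma)^{N+1}\to C^\infty(\Sigma)$ satisfying the Leibniz rule in each argument (hence local, so that it can be applied to the $x^i$). For multi-indices $I=(i_1,\dots,i_N)$, $J=(j_1,\dots,j_N)$ put $\{f,\vec x^I\}=\{f,x^{i_1},\dots,x^{i_N}\}$, $\eta_{IJ}=\eta_{i_1j_1}\cdots\eta_{i_Nj_N}$ and $\mathcal P^{iI}=\frac{1}{\sqrt{N!}}\{x^i,\vec x^I\}$, and suppose that for some $0<\gamma\in C^\infty(\Sigma)$ and $\epsilon\in\{-1,1\}$ $$\mathcal P^{iI}\mathcal P^{jJ}\eta_{IJ}=\epsilon\gamma^2 g^{ab}(\partial_a x^i)(\partial_b x^j)$$ (repeated indices are summed). Put $\mathcal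 D^{ij}=\frac{\epsilon}{\gamma^2}\mathcal P^{iI}\mathcal P^{jJ}\eta_{IJ}$ and $\mathcal D^i(f)=\frac{\epsilon}{\gamma^2N!}\{x^i,\vec x^I\}\{f,\vec x^J\}\eta_{IJ}$, and let $\Pi^i{}_j=\delta^i_j-\mathcal D^{ik}\eta_{kj}$; indices are raised and lowered with $\eta$. Let $\bar\Gamma^i_{jk}$ be the Christoffel symbols of $\eta$ and let $\hat\nabla_XT=\bar\nabla_{\mathcal D(X)}T$, $\mathcal D(X)^i=\mathcal D^{ij}\eta_{jk}X^k$, for tensor fields $T$ along $\Sigma$, that is, $$\hat\nabla_k\Pi^m{}_j=\mathcal D_k(\Pi^m{}_j)+\mathcal D_k{}^l\bar\Gamma^m_{lq}\Pi^q{}_j-\mathcal D_k{}^l\bar\Gamma^q_{lj}\Pi^m{}_q,\qquad \hat\nabla_k\Pi_{mi}=\mathcal D_k(\Pi_{mi})-\mathcal D_k{}^l\bar\Gamma^q_{lm}\Pi_{qi}-\mathcal D_k{}^l\bar\Gamma^q_{li}\Pi_{mq}.$$ Let $\bar R$ and $R$ be the curvature tensors of the Levi-Civita connections of $(M,\eta)$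 and $(\Sigma,g)$, with the conventions $R(X,Y)Z=\nabla_X\nabla_YZ-\nabla_Y\nabla_XZ-\nabla_{[X,Y]}Z$ and $R(X,Y,Z,V)=g(R(Z,V)Y,X)$, and likewise for $\bar R$ with $\bar R_{ijkl}=\bar R(\partial_i,\partial_j,\partial_k,\partial_l)$. Then for all $X,Y,Z,V$ tangent to $\Sigma$ at a point where the coordinates are defined, with components $X^i,Y^i,Z^i,V^i$ in the coordinates $x^i$, $$R(X,Y,Z,V)=\Bigl[\bar R_{ijkl}+(\hat\nabla_k\Pi_{mi})(\hat\nabla_l\Pi^m{}_j)-(\hat\nabla_k\Pi_{mj})(\hat\nabla_l\Pi^m{}_i)\Bigr]X^iY^jZ^kV^l.$$ -/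

import Mathlib

open scoped Manifold ContDiff Topology

noncomputable section

namespace MultiBracket

/-- A pseudo-Riemannian metric on an `m`-dimensional smooth manifold: a smooth field of symmetric
nondegenerate bilinear forms, of arbitrary signature, on the tangent spaces. -/
structure PseudoRiemannianMetric (m : ℕ) (M : Type*) [TopologicalSpace M]
    [ChartedSpace (EuclideanSpace ℝ (Fin m)) M] [IsManifold (𝓡 m) ∞ M] where
  /-- The bilinear form on the tangent space at `p`. -/
  form : ∀ p : M, TangentSpace (𝓡 m) p →L[ℝ] TangentSpace (𝓡 m) p →L[ℝ] ℝ
  symm : ∀ (p : M) (v w : TangentSpace (𝓡 m) p), form p v w = form p w v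
  nondegenerate : ∀ (p : M) (v : TangentSpace (𝓡 m) p), (∀ w, form p v w = 0) → v = 0
  contMDiff : ContMDiff (𝓡 m)
    ((𝓡 m).prod 𝓘(ℝ, EuclideanSpace ℝ (Fin m) →L[ℝ] EuclideanSpace ℝ (Fin m) →L[ℝ] ℝ)) ∞
    (fun p ↦ Bundle.TotalSpace.mk'
      (EuclideanSpace ℝ (Fin m) →L[ℝ] EuclideanSpace ℝ (Fin m) →L[ℝ] ℝ)
      (E := fun p : M ↦ (TangentSpace (𝓡 m) p →L[ℝ] TangentSpace (𝓡 m) p →L[ℝ] ℝ)) p (form p))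

/-! ### Levi-Civita connection and curvature in coordinates

In the next definitions `G` is the matrix of components of a metric, as a function of the
coordinates. -/

/-- The partial derivative `∂_i f` of a function of the coordinates. -/
def pderiv {m : ℕ} (i : Fin m) (f : EuclideanSpace ℝ (Fin m) → ℝ)
    (y : EuclideanSpace ℝ (Fin m)) : ℝ :=
  fderiv ℝ f y (EuclideanSpace.single i 1)

/-- The Christoffel symbol `Γ^k_{ij}` of the Levi-Civita connection,
`½ G^{kl} (∂_i G_{jl} + ∂_j G_{il} - ∂_l G_{ij})`. -/
def christoffel {m : ℕ} (G : EuclideanSpace ℝ (Fin m) → Matrix (Fin m) (Fin m) ℝ)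
    (k i j : Fin m) (y : EuclideanSpace ℝ (Fin m)) : ℝ :=
  (1 / 2) * ∑ l, (G y)⁻¹ k l *
    (pderiv i (fun z ↦ G z j l) y + pderiv j (fun z ↦ G z i l) y - pderiv l (fun z ↦ G z i j) y)

/-- The components `R^i_{jkl}` of the curvature of the Levi-Civita connection, where
`R(∂_k, ∂_l) ∂_j = R^i_{jkl} ∂_i` and
`R(X, Y) Z = ∇_X ∇_Y Z - ∇_Y ∇_X Z - ∇_{[X, Y]} Z`. -/
def riemannUp {m : ℕ} (G : EuclideanSpace ℝ (Fin m) → Matrix (Fin m) (Fin m) ℝ)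
    (i j k l : Fin m) (y : EuclideanSpace ℝ (Fin m)) : ℝ :=
  pderiv k (christoffel G i l j) y - pderiv l (christoffel G i k j) y
    + ∑ p, (christoffel G i k p y * christoffel G p l j y
      - christoffel G i l p y * christoffel G p k j y)

/-- The components `R_{ijkl} = G_{ip} R^p_{jkl}` of the curvature tensor
`R(X, Y, Z, V) = ⟨R(Z, V) Y, X⟩`. -/
def riemann {m : ℕ} (G : EuclideanSpace ℝ (Fin m) → Matrix (Fin m) (Fin m) ℝ)
    (i j k l : Fin m) (y : EuclideanSpace ℝ (Fin m)) : ℝ :=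
  ∑ p, G y i p * riemannUp G p j k l y

section Chart

variable {m : ℕ} {M : Type*} [TopologicalSpace M] [ChartedSpace (EuclideanSpace ℝ (Fin m)) M]
  [IsManifold (𝓡 m) ∞ M]

/-- The coordinate vector field `∂_i` of the chart `φ`, at the point with coordinates `y`. -/
def coordVec (φ : OpenPartialHomeomorph M (EuclideanSpace ℝ (Fin m))) (i : Fin m)
    (y : EuclideanSpace ℝ (Fin m)) : TangentSpace (𝓡 m) (φ.symm y) :=
  mfderiv (𝓡 m) (𝓡 m) φ.symm y (EuclideanSpace.single i (1 : ℝ) : EuclideanSpace ℝ (Fin m))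

/-- The components of a metric in the chart `φ`, as functions of the coordinates. -/
def metricMatrix (η : PseudoRiemannianMetric m M)
    (φ : OpenPartialHomeomorph M (EuclideanSpace ℝ (Fin m)))
    (y : EuclideanSpace ℝ (Fin m)) : Matrix (Fin m) (Fin m) ℝ :=
  Matrix.of fun i j ↦ η.form (φ.symm y) (coordVec φ i y) (coordVec φ j y)

/-- The `i`-th component of the tangent vector `X` at `p` in the chart `φ`. -/
def comp (φ : OpenPartialHomeomorph M (EuclideanSpace ℝ (Fin m))) (p : M)
    (X : TangentSpace (𝓡 m) p) (i : Fin m) : ℝ :=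
  (show EuclideanSpace ℝ (Fin m) from mfderiv (𝓡 m) (𝓡 m) φ p X) i

/-- The value `R(X, Y, Z, V) = R_{ijkl} X^i Y^j Z^k V^l` of the curvature tensor of a metric on
tangent vectors at `p`, computed in the chart `φ`. -/
def curvature (η : PseudoRiemannianMetric m M)
    (φ : OpenPartialHomeomorph M (EuclideanSpace ℝ (Fin m))) (p : M)
    (X Y Z V : TangentSpace (𝓡 m) p) : ℝ :=
  ∑ i, ∑ j, ∑ k, ∑ l, riemann (metricMatrix η φ) i j k l (φ p) *
    comp φ p X i * comp φ p Y j * comp φ p Z k * comp φ p V l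

end Chart

/-! ### Brackets -/

section Bracket

variable {n N : ℕ} {S : Type*} [TopologicalSpace S] [ChartedSpace (EuclideanSpace ℝ (Fin n)) S]

/-- An `(N+1)`-linear bracket on `C^∞(S)` that satisfies the Leibniz rule in each argument. -/
structure Bracket (n N : ℕ) (S : Type*) [TopologicalSpace S]
    [ChartedSpace (EuclideanSpace ℝ (Fin n)) S] where
  toMultilinearMap :
    MultilinearMap ℝ (fun _ : Fin (N + 1) ↦ C^∞⟮𝓡 n, S; ℝ⟯) C^∞⟮𝓡 n, S; ℝ⟯
  leibniz : ∀ (F : Fin (N + 1) → C^∞⟮𝓡 n, S; ℝ⟯) (k : Fin (N + 1)) (f g : C^∞⟮𝓡 n, S; ℝ⟯),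
    toMultilinearMap (Function.update F k (f * g)) =
      f * toMultilinearMap (Function.update F k g) + g * toMultilinearMap (Function.update F k f)

open Classical in
/-- A function in `C^∞(S)` that agrees near `p` with the given function, which has to be smooth
near `p` only (such as a coordinate function). -/
def extend (f : S → ℝ) (p : S) : C^∞⟮𝓡 n, S; ℝ⟯ :=
  if h : ∃ F : C^∞⟮𝓡 n, S; ℝ⟯, ∀ᶠ q in 𝓝 p, F q = f q then h.choose else 0

/-- The value `{f_0, …, f_N}(p)` for functions that are smooth near `p`. By the Leibniz rule the
value of the bracket at `p` depends only on the germs of its arguments at `p`. -/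
def Bracket.at (B : Bracket n N S) (f : Fin (N + 1) → S → ℝ) (p : S) : ℝ :=
  B.toMultilinearMap (fun k ↦ extend (f k) p) p

end Bracket

/-- A submanifold `ι : S → M` of a pseudo-Riemannian manifold with a bracket on `C^∞(S)`, a
function `γ`, a sign `ε`, and charts `φ` of `M` and `ψ` of `S`, i.e. coordinates `x^i` and
`u^a`. -/
structure Setting (m n N : ℕ) (M S : Type*)
    [TopologicalSpace M] [ChartedSpace (EuclideanSpace ℝ (Fin m)) M] [IsManifold (𝓡 m) ∞ M]
    [TopologicalSpace S] [ChartedSpace (EuclideanSpace ℝ (Fin n)) S]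
    [IsManifold (𝓡 n) ∞ S] where
  /-- The metric of `M`. -/
  η : PseudoRiemannianMetric m M
  /-- The metric of `S`. -/
  g : PseudoRiemannianMetric n S
  /-- The inclusion of `S` in `M`; the metric of `S` is induced by it, so that `ι` is an
  immersion. -/
  ι : S → M
  ι_smooth : ContMDiff (𝓡 n) (𝓡 m) ∞ ι
  induced : ∀ (p : S) (X Y : TangentSpace (𝓡 n) p),
    g.form p X Y = η.form (ι p) (mfderiv (𝓡 n) (𝓡 m) ι p X) (mfderiv (𝓡 n) (𝓡 m) ι p Y)
  /-- The bracket. -/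
  B : Bracket n N S
  /-- The positive factor in the relation between bracket and metric. -/
  γ : C^∞⟮𝓡 n, S; ℝ⟯
  γ_pos : ∀ p, 0 < γ p
  /-- The sign in the relation between bracket and metric. -/
  ε : ℝ
  ε_sign : ε = 1 ∨ ε = -1
  /-- The chart of `M`. -/
  φ : OpenPartialHomeomorph M (EuclideanSpace ℝ (Fin m))
  φ_mem : φ ∈ IsManifold.maximalAtlas (𝓡 m) ∞ M
  /-- The chart of `S`. -/
  ψ : OpenPartialHomeomorph S (EuclideanSpace ℝ (Fin n))
  ψ_mem : ψ ∈ IsManifold.maximalAtlas (𝓡 n) ∞ S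

namespace Setting

variable {m n N : ℕ} {M S : Type*}
  [TopologicalSpace M] [ChartedSpace (EuclideanSpace ℝ (Fin m)) M] [IsManifold (𝓡 m) ∞ M]
  [TopologicalSpace S] [ChartedSpace (EuclideanSpace ℝ (Fin n)) S] [IsManifold (𝓡 n) ∞ S]
  (𝒮 : Setting m n N M S)

/-- The coordinate functions `x^i` of `M`, restricted to `S`. -/
def x (i : Fin m) (p : S) : ℝ := 𝒮.φ (𝒮.ι p) i

/-- The components `η_{ij}` of the metric of `M` along `S`. -/
def ηc (i j : Fin m) (p : S) : ℝ := metricMatrix 𝒮.η 𝒮.φ (𝒮.φ (𝒮.ι p)) i j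

/-- The Christoffel symbols `Γ̄^k_{ij}` of `M` along `S`. -/
def Γ (k i j : Fin m) (p : S) : ℝ :=
  christoffel (metricMatrix 𝒮.η 𝒮.φ) k i j (𝒮.φ (𝒮.ι p))

/-- The components `R̄_{ijkl}` of the curvature of `M` along `S`. -/
def Rbar (i j k l : Fin m) (p : S) : ℝ :=
  riemann (metricMatrix 𝒮.η 𝒮.φ) i j k l (𝒮.φ (𝒮.ι p))

/-- The components `X^i` in the coordinates of `M` of a vector tangent to `S`. -/
def vec (p : S) (X : TangentSpace (𝓡 n) p) (i : Fin m) : ℝ :=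
  comp 𝒮.φ (𝒮.ι p) (mfderiv (𝓡 n) (𝓡 m) 𝒮.ι p X) i

/-- The bracket `{f, x^{i_1}, …, x^{i_N}}` for a multi-index `I = (i_1, …, i_N)`. -/
def brx (f : S → ℝ) (I : Fin N → Fin m) (p : S) : ℝ :=
  𝒮.B.at (Fin.cons f fun r ↦ 𝒮.x (I r)) p

/-- `η_{IJ} = η_{i_1 j_1} ⋯ η_{i_N j_N}`. -/
def ηMulti (I J : Fin N → Fin m) (p : S) : ℝ := ∏ r, 𝒮.ηc (I r) (J r) p

/-- `P^{iI} = {x^i, x^I} / √(N!)`. -/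
def P (i : Fin m) (I : Fin N → Fin m) (p : S) : ℝ :=
  1 / Real.sqrt (N.factorial) * 𝒮.brx (𝒮.x i) I p

/-- The relation `P^{iI} P^{jJ} η_{IJ} = ε γ² g^{ab} (∂_a x^i) (∂_b x^j)` between the bracket and
the metric, on the common domain of the coordinates. -/
def Compatible : Prop :=
  ∀ p ∈ 𝒮.ψ.source, 𝒮.ι p ∈ 𝒮.φ.source → ∀ i j : Fin m,
    ∑ I : Fin N → Fin m, ∑ J : Fin N → Fin m, 𝒮.P i I p * 𝒮.P j J p * 𝒮.ηMulti I J p =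
      𝒮.ε * 𝒮.γ p ^ 2 * ∑ a, ∑ b, (metricMatrix 𝒮.g 𝒮.ψ (𝒮.ψ p))⁻¹ a b *
        pderiv a (fun u ↦ 𝒮.x i (𝒮.ψ.symm u)) (𝒮.ψ p) *
        pderiv b (fun u ↦ 𝒮.x j (𝒮.ψ.symm u)) (𝒮.ψ p)

/-- `D^{ij} = (ε / γ²) P^{iI} P^{jJ} η_{IJ}`. -/
def D (i j : Fin m) (p : S) : ℝ :=
  𝒮.ε / 𝒮.γ p ^ 2 *
    ∑ I : Fin N → Fin m, ∑ J : Fin N → Fin m, 𝒮.P i I p * 𝒮.P j J p * 𝒮.ηMulti I J p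

/-- `D_j^l = η_{ji} D^{il}`. -/
def Dlow (j l : Fin m) (p : S) : ℝ := ∑ i, 𝒮.ηc j i p * 𝒮.D i l p

/-- The derivation `D^i(f) = ε / (γ² N!) {x^i, x^I} {f, x^J} η_{IJ}`. -/
def Dder (i : Fin m) (f : S → ℝ) (p : S) : ℝ :=
  𝒮.ε / (𝒮.γ p ^ 2 * N.factorial) *
    ∑ I : Fin N → Fin m, ∑ J : Fin N → Fin m,
      𝒮.brx (𝒮.x i) I p * 𝒮.brx f J p * 𝒮.ηMulti I J p

/-- The derivation `D_j(f) = η_{ji} D^i(f)`. -/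
def DderLow (j : Fin m) (f : S → ℝ) (p : S) : ℝ := ∑ i, 𝒮.ηc j i p * 𝒮.Dder i f p

/-- The components `Π^i_j = δ^i_j - D^{ik} η_{kj}` of the complementary projection
`Π = 1 - D`. -/
def Proj (i j : Fin m) (p : S) : ℝ :=
  (if i = j then 1 else 0) - ∑ k, 𝒮.D i k p * 𝒮.ηc k j p

/-- `Π_{ij} = η_{ik} Π^k_j`. -/
def ProjLow (i j : Fin m) (p : S) : ℝ := ∑ k, 𝒮.ηc i k p * 𝒮.Proj k j p

/-- The covariant derivative `∇̂_k T^i_j`, where `∇̂_X = ∇̄_{D(X)}`, of a tensor field of type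
`(1, 1)` along `S`. -/
def nablaHat (T : Fin m → Fin m → S → ℝ) (k i j : Fin m) (p : S) : ℝ :=
  𝒮.DderLow k (T i j) p
    + ∑ l, ∑ q, 𝒮.Dlow k l p * 𝒮.Γ i l q p * T q j p
    - ∑ l, ∑ q, 𝒮.Dlow k l p * 𝒮.Γ q l j p * T i q p

/-- The covariant derivative `∇̂_k T_{ij}`, where `∇̂_X = ∇̄_{D(X)}`, of a tensor field of type
`(0, 2)` along `S`. -/
def nablaHatLow (T : Fin m → Fin m → S → ℝ) (k i j : Fin m) (p : S) : ℝ :=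
  𝒮.DderLow k (T i j) p
    - ∑ l, ∑ q, 𝒮.Dlow k l p * 𝒮.Γ q l i p * T q j p
    - ∑ l, ∑ q, 𝒮.Dlow k l p * 𝒮.Γ q l j p * T i q p

end Setting

end MultiBracket

end

/-! The claim is Gauss's equation in disguise. In coordinates the submanifold is a map F from `Coord
n` to `Coord m`. Gauss's equation expresses R − R̄ by inner products of the normal parts of ∇_c ∂_b
F, that is, by the second fundamental form; `riemann_eq` proves it for any smooth F with
nondegenerate pullback metric. It remains to recognise these normal parts in the derivatives of Π.

With its other arguments fixed, f ↦ {f, x^J}(p) is a derivation at p by the Leibniz rule, hence a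
combination of the ∂_a f (`pointDerivation_eq_sum`, from Hadamard's lemma). So D^i(f) = W^{ia} ∂_a f
with unknown W. For f = x^j the compatibility relation gives the value g^{ab} ∂_a x^i ∂_b x^j; as
the ∂_a F are linearly independent, W^{ia} = g^{ab} ∂_b x^i (`Dder_eq`). Consequently Π is the
orthogonal projection to the normal space, and contracting the index k of ∇̂_k with ∂_c F yields the
covariant derivative in the direction ∂_c.

Since Π annihilates each ∂_b F, differentiating Π(∂_b F) = 0 gives (∇_c Π)(∂_b F) = −Π(∇_c ∂_b F)
(`sum_covd_tensor`). The two signs cancel in each product, and `sum_normalProjLow_mul` turns the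
product into the inner product of normal parts that Gauss's equation asks for. -/

noncomputable section

namespace MultiBracket

/-! ### Partial derivatives -/

/-- The model space `ℝ^m` with its Euclidean norm. -/
abbrev Coord (m : ℕ) := EuclideanSpace ℝ (Fin m)

section pderiv

variable {m n : ℕ} {U : Set (Coord n)} {u : Coord n}

theorem pderiv_congr {f f' : Coord n → ℝ} (h : f =ᶠ[𝓝 u] f') (a : Fin n) :
    pderiv a f u = pderiv a f' u := by
  rw [pderiv, pderiv, h.fderiv_eq]

theorem pderiv_congr_on (hU : IsOpen U) (hu : u ∈ U) {f f' : Coord n → ℝ}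
    (h : ∀ z ∈ U, f z = f' z) (a : Fin n) : pderiv a f u = pderiv a f' u :=
  pderiv_congr (Filter.eventually_of_mem (hU.mem_nhds hu) h) a

theorem pderiv_const (c : ℝ) (a : Fin n) : pderiv a (fun _ ↦ c) u = 0 := by
  simp [pderiv]

theorem pderiv_add {f f' : Coord n → ℝ} (hf : DifferentiableAt ℝ f u)
    (hf' : DifferentiableAt ℝ f' u) (a : Fin n) :
    pderiv a (fun z ↦ f z + f' z) u = pderiv a f u + pderiv a f' u := by
  simp [pderiv, fderiv_fun_add hf hf']

theorem pderiv_mul {f f' : Coord n → ℝ} (hf : DifferentiableAt ℝ f u)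
    (hf' : DifferentiableAt ℝ f' u) (a : Fin n) :
    pderiv a (fun z ↦ f z * f' z) u = pderiv a f u * f' u + f u * pderiv a f' u := by
  simp [pderiv, fderiv_fun_mul hf hf']
  ring

theorem pderiv_sum {κ : Type*} (s : Finset κ) {f : κ → Coord n → ℝ}
    (hf : ∀ k ∈ s, DifferentiableAt ℝ (f k) u) (a : Fin n) :
    pderiv a (fun z ↦ ∑ k ∈ s, f k z) u = ∑ k ∈ s, pderiv a (f k) u := by
  simp [pderiv, fderiv_fun_sum hf]

theorem pderiv_coord (a b : Fin n) (c : ℝ) :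
    pderiv a (fun z ↦ z b - c) u = if a = b then 1 else 0 := by
  have h : HasFDerivAt (fun z : Coord n ↦ z b - c) (EuclideanSpace.proj b : Coord n →L[ℝ] ℝ) u :=
    (EuclideanSpace.proj b : Coord n →L[ℝ] ℝ).hasFDerivAt.sub_const c
  rw [pderiv, h.fderiv]
  simp [eq_comm]

theorem fderiv_eq_sum_pderiv (f : Coord n → ℝ) (v : Coord n) :
    fderiv ℝ f u v = ∑ a, pderiv a f u * v a := by
  conv_lhs => rw [← (EuclideanSpace.basisFun (Fin n) ℝ).sum_repr v]
  simp [pderiv, mul_comm]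

theorem pderiv_comp {F : Coord n → Coord m} {f : Coord m → ℝ}
    (hf : DifferentiableAt ℝ f (F u)) (hF : DifferentiableAt ℝ F u) (a : Fin n) :
    pderiv a (fun z ↦ f (F z)) u = ∑ i, pderiv i f (F u) * pderiv a (fun z ↦ F z i) u := by
  have h1 : fderiv ℝ (fun z ↦ f (F z)) u = (fderiv ℝ f (F u)).comp (fderiv ℝ F u) :=
    fderiv_comp u hf hF
  have h2 : ∀ i, pderiv a (fun z ↦ F z i) u = fderiv ℝ F u (EuclideanSpace.single a 1) i := by
    intro i
    have h := ((EuclideanSpace.proj i : Coord m →L[ℝ] ℝ).hasFDerivAt.comp u hF.hasFDerivAt)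
    have h' : HasFDerivAt (fun z ↦ F z i)
      ((EuclideanSpace.proj i : Coord m →L[ℝ] ℝ).comp (fderiv ℝ F u)) u := h
    rw [pderiv, h'.fderiv]
    rfl
  rw [pderiv, h1]
  simp only [h2]
  exact fderiv_eq_sum_pderiv f _

theorem contDiffOn_pderiv (hU : IsOpen U) {f : Coord n → ℝ} (hf : ContDiffOn ℝ ∞ f U)
    (a : Fin n) : ContDiffOn ℝ ∞ (pderiv a f) U :=
  (hf.fderiv_of_isOpen hU (m := ∞) (by simp)).clm_apply contDiffOn_const

theorem differentiableAt_of_contDiffOn (hU : IsOpen U) (hu : u ∈ U) {F : Type*}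
    [NormedAddCommGroup F] [NormedSpace ℝ F] {f : Coord n → F}
    (hf : ContDiffOn ℝ ∞ f U) : DifferentiableAt ℝ f u :=
  (hf.contDiffAt (hU.mem_nhds hu)).differentiableAt (by simp)

theorem pderiv_comm (hU : IsOpen U) (hu : u ∈ U) {f : Coord n → ℝ} (hf : ContDiffOn ℝ ∞ f U)
    (a b : Fin n) : pderiv a (pderiv b f) u = pderiv b (pderiv a f) u := by
  have hd : DifferentiableAt ℝ (fderiv ℝ f) u :=
    differentiableAt_of_contDiffOn hU hu (hf.fderiv_of_isOpen hU (m := ∞) (by simp))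
  have key : ∀ a b : Fin n, pderiv a (pderiv b f) u =
      fderiv ℝ (fderiv ℝ f) u (EuclideanSpace.single a 1) (EuclideanSpace.single b 1) := by
    intro a b
    have : HasFDerivAt (pderiv b f)
        ((fderiv ℝ (fderiv ℝ f) u).flip (EuclideanSpace.single b 1)) u := by
      refine (hd.hasFDerivAt.clm_apply
        (hasFDerivAt_const (EuclideanSpace.single b (1 : ℝ)) u)).congr_fderiv ?_
      ext
      simp
    rw [pderiv, this.fderiv]
    rfl
  rw [key, key]
  exact ((hf.contDiffAt (hU.mem_nhds hu)).isSymmSndFDerivAt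
    (by rw [minSmoothness_of_isRCLikeNormedField]; exact ENat.LEInfty.out)) _ _

end pderiv

/-! ### Christoffel symbols -/

section Christoffel

variable {m : ℕ} {G : Coord m → Matrix (Fin m) (Fin m) ℝ} {W : Set (Coord m)} {y : Coord m}

theorem contDiffOn_det {ι : Type*} [Fintype ι] [DecidableEq ι] {A : Coord m → Matrix ι ι ℝ}
    (hA : ∀ i j, ContDiffOn ℝ ∞ (fun z ↦ A z i j) W) : ContDiffOn ℝ ∞ (fun z ↦ (A z).det) W := by
  simp only [Matrix.det_apply']
  exact ContDiffOn.sum fun σ _ ↦ contDiffOn_const.mul (contDiffOn_prod fun i _ ↦ hA _ _)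

/-- Cramer's rule: an entry of the inverse is a determinant with one row replaced by a constant unit
vector, divided by the nonvanishing determinant. -/
theorem contDiffOn_inv_entry {ι : Type*} [Fintype ι] [DecidableEq ι] {A : Coord m → Matrix ι ι ℝ}
    (hA : ∀ i j, ContDiffOn ℝ ∞ (fun z ↦ A z i j) W) (hu : ∀ z ∈ W, IsUnit (A z).det) (i j : ι) :
    ContDiffOn ℝ ∞ (fun z ↦ (A z)⁻¹ i j) W := by
  simp only [Matrix.inv_def, Matrix.smul_apply, Ring.inverse_eq_inv', smul_eq_mul,
    Matrix.adjugate_apply]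
  refine ((contDiffOn_det hA).inv fun z hz ↦ (hu z hz).ne_zero).mul (contDiffOn_det fun k l ↦ ?_)
  by_cases hk : k = j
  · subst hk
    simpa using contDiffOn_const
  · simpa [Matrix.updateRow_apply, hk] using hA k l

/-- A smooth pseudo-Riemannian metric, given by its matrix of components, on an open set. -/
structure IsMetricOn (G : Coord m → Matrix (Fin m) (Fin m) ℝ) (W : Set (Coord m)) : Prop where
  isOpen : IsOpen W
  smooth : ∀ i j, ContDiffOn ℝ ∞ (fun z ↦ G z i j) W
  symm : ∀ z ∈ W, ∀ i j, G z i j = G z j i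
  isUnit : ∀ z ∈ W, IsUnit (G z).det

namespace IsMetricOn

theorem inv_symm (hG : IsMetricOn G W) (hy : y ∈ W) (i j : Fin m) :
    (G y)⁻¹ i j = (G y)⁻¹ j i := by
  have h : (G y).transpose = G y := by
    ext i j
    exact hG.symm y hy j i
  have h' : (G y)⁻¹.transpose = (G y)⁻¹ := by rw [Matrix.transpose_nonsing_inv, h]
  conv_lhs => rw [← h']
  rfl

theorem sum_mul_inv (hG : IsMetricOn G W) (hy : y ∈ W) (i j : Fin m) :
    ∑ k, G y i k * (G y)⁻¹ k j = if i = j then 1 else 0 := by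
  have := congrFun (congrFun (Matrix.mul_nonsing_inv (G y) (hG.isUnit y hy)) i) j
  simpa [Matrix.mul_apply, Matrix.one_apply] using this

theorem contDiffOn_christoffel (hG : IsMetricOn G W) (k i j : Fin m) :
    ContDiffOn ℝ ∞ (christoffel G k i j) W := by
  unfold christoffel
  refine contDiffOn_const.mul (ContDiffOn.sum fun l _ ↦ ?_)
  refine (contDiffOn_inv_entry hG.smooth hG.isUnit k l).mul ?_
  exact ((contDiffOn_pderiv hG.isOpen (hG.smooth _ _) _).add
    (contDiffOn_pderiv hG.isOpen (hG.smooth _ _) _)).sub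
    (contDiffOn_pderiv hG.isOpen (hG.smooth _ _) _)

theorem pderiv_symm (hG : IsMetricOn G W) (hy : y ∈ W) (i j k : Fin m) :
    pderiv k (fun z ↦ G z i j) y = pderiv k (fun z ↦ G z j i) y :=
  pderiv_congr_on hG.isOpen hy (fun z hz ↦ hG.symm z hz i j) k

theorem christoffel_symm (hG : IsMetricOn G W) (hy : y ∈ W) (k i j : Fin m) :
    christoffel G k i j y = christoffel G k j i y := by
  unfold christoffel
  congr 1
  refine Finset.sum_congr rfl fun l _ ↦ ?_
  rw [hG.pderiv_symm hy i j l]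
  ring

theorem sum_mul_christoffel (hG : IsMetricOn G W) (hy : y ∈ W) (l i j : Fin m) :
    ∑ k, G y l k * christoffel G k i j y = (1 / 2) * (pderiv i (fun z ↦ G z j l) y
      + pderiv j (fun z ↦ G z i l) y - pderiv l (fun z ↦ G z i j) y) := by
  unfold christoffel
  set t : Fin m → ℝ := fun l ↦ pderiv i (fun z ↦ G z j l) y
      + pderiv j (fun z ↦ G z i l) y - pderiv l (fun z ↦ G z i j) y with ht
  change ∑ k, G y l k * ((1 / 2) * ∑ q, (G y)⁻¹ k q * t q) = (1 / 2) * t l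
  calc _ = (1 / 2) * ∑ q, (∑ k, G y l k * (G y)⁻¹ k q) * t q := by
        simp only [Finset.mul_sum, Finset.sum_mul]
        rw [Finset.sum_comm]
        exact Finset.sum_congr rfl fun _ _ ↦ Finset.sum_congr rfl fun _ _ ↦ by ring
    _ = _ := by simp [hG.sum_mul_inv hy]

/-- Metric compatibility ∇G = 0: in the sum of the two lowered Christoffel symbols all derivatives
cancel in pairs except ∂_k G_{ij}, which occurs twice with the factor ½. -/
theorem pderiv_eq_christoffel (hG : IsMetricOn G W) (hy : y ∈ W) (k i j : Fin m) :
    pderiv k (fun z ↦ G z i j) y =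
      ∑ l, G y j l * christoffel G l k i y + ∑ l, G y i l * christoffel G l k j y := by
  rw [hG.sum_mul_christoffel hy, hG.sum_mul_christoffel hy, hG.pderiv_symm hy j i k,
    hG.pderiv_symm hy k i j, hG.pderiv_symm hy k j i]
  ring

end IsMetricOn

end Christoffel

/-! ### Vector fields along a map -/

section Along

variable {m n : ℕ}

theorem sum_reverse {α β γ : Type*} [Fintype α] [Fintype β] [Fintype γ] (f : α → β → γ → ℝ) :
    ∑ i, ∑ j, ∑ k, f i j k = ∑ k, ∑ j, ∑ i, f i j k := by
  rw [Finset.sum_comm]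
  simp only [Finset.sum_comm (s := (Finset.univ : Finset α))]
  exact Finset.sum_comm

/-- The bilinear form with matrix `A`. -/
def bil (A : Matrix (Fin m) (Fin m) ℝ) (v w : Fin m → ℝ) : ℝ := ∑ i, ∑ j, A i j * v i * w j

theorem bil_symm {A : Matrix (Fin m) (Fin m) ℝ} (hA : ∀ i j, A i j = A j i) (v w : Fin m → ℝ) :
    bil A v w = bil A w v := by
  unfold bil
  rw [Finset.sum_comm]
  exact Finset.sum_congr rfl fun i _ ↦ Finset.sum_congr rfl fun j _ ↦ by rw [hA j i]; ring

theorem bil_sub_left (A : Matrix (Fin m) (Fin m) ℝ) (v v' w : Fin m → ℝ) :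
    bil A (v - v') w = bil A v w - bil A v' w := by
  simp only [bil, Pi.sub_apply, ← Finset.sum_sub_distrib]
  exact Finset.sum_congr rfl fun i _ ↦ Finset.sum_congr rfl fun j _ ↦ by ring

/-- The components of the coordinate vector field `∂_a F` along the map `F`. -/
def tang (F : Coord n → Coord m) (a : Fin n) (u : Coord n) (i : Fin m) : ℝ :=
  pderiv a (fun z ↦ F z i) u

/-- The covariant derivative along `F`, in the direction `∂_a`, of a vector field `v` along `F`. -/
def covd (G : Coord m → Matrix (Fin m) (Fin m) ℝ) (F : Coord n → Coord m) (a : Fin n)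
    (v : Coord n → Fin m → ℝ) (u : Coord n) (i : Fin m) : ℝ :=
  pderiv a (fun z ↦ v z i) u
    + ∑ l, ∑ q, christoffel G i l q (F u) * tang F a u l * v u q

/-- A smooth map `F` from an open set `U` to an open set `W` with a metric `G`, such that the
pullback `g` of `G` is nondegenerate. -/
structure IsImmersionOn (G : Coord m → Matrix (Fin m) (Fin m) ℝ) (W : Set (Coord m))
    (F : Coord n → Coord m) (g : Coord n → Matrix (Fin n) (Fin n) ℝ) (U : Set (Coord n)) :
    Prop where
  target : IsMetricOn G W
  source : IsMetricOn g U
  smooth : ContDiffOn ℝ ∞ F U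
  mapsTo : ∀ u ∈ U, F u ∈ W
  pullback : ∀ u ∈ U, ∀ a b, g u a b = bil (G (F u)) (tang F a u) (tang F b u)

namespace IsImmersionOn

variable {G : Coord m → Matrix (Fin m) (Fin m) ℝ} {W : Set (Coord m)}
  {F : Coord n → Coord m} {g : Coord n → Matrix (Fin n) (Fin n) ℝ} {U : Set (Coord n)}
  {u : Coord n}

theorem smooth_coord (h : IsImmersionOn G W F g U) (i : Fin m) :
    ContDiffOn ℝ ∞ (fun z ↦ F z i) U :=
  (EuclideanSpace.proj i : Coord m →L[ℝ] ℝ).contDiff.comp_contDiffOn h.smooth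

theorem smooth_tang (h : IsImmersionOn G W F g U) (a : Fin n) (i : Fin m) :
    ContDiffOn ℝ ∞ (fun z ↦ tang F a z i) U :=
  contDiffOn_pderiv h.source.isOpen (h.smooth_coord i) a

theorem smooth_comp (h : IsImmersionOn G W F g U) {f : Coord m → ℝ} (hf : ContDiffOn ℝ ∞ f W) :
    ContDiffOn ℝ ∞ (fun z ↦ f (F z)) U :=
  hf.comp h.smooth h.mapsTo

theorem smooth_covd (h : IsImmersionOn G W F g U) {v : Coord n → Fin m → ℝ}
    (hv : ∀ i, ContDiffOn ℝ ∞ (fun z ↦ v z i) U) (a : Fin n) (i : Fin m) :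
    ContDiffOn ℝ ∞ (fun z ↦ covd G F a v z i) U := by
  unfold covd
  refine (contDiffOn_pderiv h.source.isOpen (hv i) a).add ?_
  exact ContDiffOn.sum fun l _ ↦ ContDiffOn.sum fun q _ ↦
    ((h.smooth_comp (h.target.contDiffOn_christoffel _ _ _)).mul (h.smooth_tang _ _)).mul (hv _)

theorem diffAt (h : IsImmersionOn G W F g U) (hu : u ∈ U) {f : Coord n → ℝ}
    (hf : ContDiffOn ℝ ∞ f U) : DifferentiableAt ℝ f u :=
  differentiableAt_of_contDiffOn h.source.isOpen hu hf

theorem pderiv_pullback (h : IsImmersionOn G W F g U) (hu : u ∈ U) {f : Coord m → ℝ}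
    (hf : ContDiffOn ℝ ∞ f W) (a : Fin n) :
    pderiv a (fun z ↦ f (F z)) u = ∑ i, pderiv i f (F u) * tang F a u i :=
  pderiv_comp (differentiableAt_of_contDiffOn h.target.isOpen (h.mapsTo u hu) hf)
    (differentiableAt_of_contDiffOn h.source.isOpen hu h.smooth) a

theorem tang_comm (h : IsImmersionOn G W F g U) (hu : u ∈ U) (a b : Fin n) (i : Fin m) :
    pderiv a (fun z ↦ tang F b z i) u = pderiv b (fun z ↦ tang F a z i) u :=
  pderiv_comm h.source.isOpen hu (h.smooth_coord i) a b

/-- Absence of torsion: second partial derivatives commute and the Christoffel symbols are symmetric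
in their lower indices. -/
theorem covd_tang_symm (h : IsImmersionOn G W F g U) (hu : u ∈ U) (a b : Fin n) :
    covd G F a (tang F b) u = covd G F b (tang F a) u := by
  funext i
  unfold covd
  rw [h.tang_comm hu a b i, Finset.sum_comm]
  congr 1
  refine Finset.sum_congr rfl fun l _ ↦ Finset.sum_congr rfl fun q _ ↦ ?_
  rw [h.target.christoffel_symm (h.mapsTo u hu)]
  ring

/-- Compatibility of the covariant derivative along `F` with the metric. -/
theorem pderiv_bil (h : IsImmersionOn G W F g U) (hu : u ∈ U) {v w : Coord n → Fin m → ℝ}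
    (hv : ∀ i, ContDiffOn ℝ ∞ (fun z ↦ v z i) U) (hw : ∀ i, ContDiffOn ℝ ∞ (fun z ↦ w z i) U)
    (a : Fin n) :
    pderiv a (fun z ↦ bil (G (F z)) (v z) (w z)) u =
      bil (G (F u)) (covd G F a v u) (w u) + bil (G (F u)) (v u) (covd G F a w u) := by
  have hG : ∀ i j, ContDiffOn ℝ ∞ (fun z ↦ G (F z) i j) U := fun i j ↦
    h.smooth_comp (h.target.smooth i j)
  have e1 : pderiv a (fun z ↦ bil (G (F z)) (v z) (w z)) u =
      ∑ i, ∑ j, (pderiv a (fun z ↦ G (F z) i j) u * v u i * w u j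
        + G (F u) i j * pderiv a (fun z ↦ v z i) u * w u j
        + G (F u) i j * v u i * pderiv a (fun z ↦ w z j) u) := by
    unfold bil
    rw [pderiv_sum _ fun i _ ↦ h.diffAt hu
      (ContDiffOn.sum fun j _ ↦ ((hG i j).mul (hv i)).mul (hw j))]
    refine Finset.sum_congr rfl fun i _ ↦ ?_
    rw [pderiv_sum _ fun j _ ↦ h.diffAt hu (((hG i j).mul (hv i)).mul (hw j))]
    refine Finset.sum_congr rfl fun j _ ↦ ?_
    rw [pderiv_mul (h.diffAt hu ((hG i j).mul (hv i))) (h.diffAt hu (hw j)),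
      pderiv_mul (h.diffAt hu (hG i j)) (h.diffAt hu (hv i))]
    ring
  -- Chain rule followed by ∇G = 0. Each of the two Christoffel terms is the one missing to turn a
  -- partial derivative of `v` or `w` into a covariant one (`e3`, `e4`).
  have e2 : ∀ i j, pderiv a (fun z ↦ G (F z) i j) u =
      ∑ k, ∑ l, (G (F u) j l * christoffel G l k i (F u) * tang F a u k
        + G (F u) i l * christoffel G l k j (F u) * tang F a u k) := by
    intro i j
    rw [h.pderiv_pullback hu (h.target.smooth i j)]
    refine Finset.sum_congr rfl fun k _ ↦ ?_
    rw [h.target.pderiv_eq_christoffel (h.mapsTo u hu), ← Finset.sum_add_distrib, Finset.sum_mul]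
    exact Finset.sum_congr rfl fun l _ ↦ by ring
  have e3 : ∑ i, ∑ j, (∑ k, ∑ l, G (F u) j l * christoffel G l k i (F u) * tang F a u k)
      * v u i * w u j = ∑ i, ∑ j, G (F u) i j *
        (∑ k, ∑ q, christoffel G i k q (F u) * tang F a u k * v u q) * w u j := by
    conv_lhs => rw [Finset.sum_comm]
    conv_rhs => rw [Finset.sum_comm]
    refine Finset.sum_congr rfl fun j _ ↦ ?_
    simp only [Finset.mul_sum, Finset.sum_mul]
    rw [sum_reverse]
    refine Finset.sum_congr rfl fun l _ ↦ Finset.sum_congr rfl fun k _ ↦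
      Finset.sum_congr rfl fun i _ ↦ ?_
    rw [h.target.symm (F u) (h.mapsTo u hu) l j]
    ring
  have e4 : ∑ i, ∑ j, (∑ k, ∑ l, G (F u) i l * christoffel G l k j (F u) * tang F a u k)
      * v u i * w u j = ∑ i, ∑ j, G (F u) i j * v u i *
        (∑ k, ∑ q, christoffel G j k q (F u) * tang F a u k * w u q) := by
    refine Finset.sum_congr rfl fun i _ ↦ ?_
    simp only [Finset.mul_sum, Finset.sum_mul]
    rw [sum_reverse]
    exact Finset.sum_congr rfl fun l _ ↦ Finset.sum_congr rfl fun k _ ↦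
      Finset.sum_congr rfl fun i _ ↦ by ring
  rw [e1]
  simp only [e2, bil, covd, Finset.sum_add_distrib, mul_add, add_mul, e3, e4]
  ring


/-! ### The Gauss equation for an immersion -/

theorem pderiv_metric (h : IsImmersionOn G W F g U) (hu : u ∈ U) (a b c : Fin n) :
    pderiv a (fun z ↦ g z b c) u =
      bil (G (F u)) (covd G F a (tang F b) u) (tang F c u)
        + bil (G (F u)) (covd G F a (tang F c) u) (tang F b u) := by
  rw [pderiv_congr_on h.source.isOpen hu (fun z hz ↦ h.pullback z hz b c),
    h.pderiv_bil hu (h.smooth_tang b) (h.smooth_tang c),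
    bil_symm (h.target.symm _ (h.mapsTo u hu)) (tang F b u)]

/-- The tangential part of the covariant derivative of the coordinate fields along an immersion is
given by the Levi-Civita connection of the pullback metric. -/
theorem bil_covd_tang (h : IsImmersionOn G W F g U) (hu : u ∈ U) (a b c : Fin n) :
    bil (G (F u)) (covd G F a (tang F b) u) (tang F c u) =
      ∑ e, g u c e * christoffel g e a b u := by
  -- Koszul's formula: the three metric derivatives produce six inner products, and by the symmetry
  -- of ∇_a ∂_b F all cancel but two equal ones.
  rw [h.source.sum_mul_christoffel hu, h.pderiv_metric hu, h.pderiv_metric hu, h.pderiv_metric hu,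
    h.covd_tang_symm hu b a, h.covd_tang_symm hu c a, h.covd_tang_symm hu c b]
  ring

/-- The inner product of the components normal to the immersion,
`⟨v, w⟩ - g^{ef} ⟨v, ∂_e F⟩ ⟨w, ∂_f F⟩`. -/
def _root_.MultiBracket.normalBil (G : Coord m → Matrix (Fin m) (Fin m) ℝ) (F : Coord n → Coord m)
    (g : Coord n → Matrix (Fin n) (Fin n) ℝ) (u : Coord n) (v w : Fin m → ℝ) : ℝ :=
  bil (G (F u)) v w - ∑ e, ∑ f, (g u)⁻¹ e f * bil (G (F u)) v (tang F e u)
    * bil (G (F u)) w (tang F f u)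

theorem inv_mul_metric (h : IsImmersionOn G W F g U) (hu : u ∈ U) (e k : Fin n) :
    ∑ f, (g u)⁻¹ e f * g u f k = if e = k then 1 else 0 := by
  have := congrFun (congrFun (Matrix.nonsing_inv_mul (g u) (h.source.isUnit u hu)) e) k
  simpa [Matrix.mul_apply, Matrix.one_apply] using this

theorem christoffel_eq (h : IsImmersionOn G W F g U) (hu : u ∈ U) (a b e : Fin n) :
    christoffel g e a b u = ∑ f, (g u)⁻¹ e f *
      bil (G (F u)) (covd G F a (tang F b) u) (tang F f u) := by
  calc christoffel g e a b u
      = ∑ k, (∑ f, (g u)⁻¹ e f * g u f k) * christoffel g k a b u := by simp [h.inv_mul_metric hu]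
    _ = _ := by
        simp only [h.bil_covd_tang hu, Finset.mul_sum, Finset.sum_mul]
        rw [Finset.sum_comm]
        exact Finset.sum_congr rfl fun _ _ ↦ Finset.sum_congr rfl fun _ _ ↦ by ring

/-- One half of the Gauss equation; antisymmetrising in `c`, `d` gives the whole. It comes from
computing ∂_c⟨∇_d ∂_b F, ∂_a F⟩ twice: by metric compatibility (`e1`), and from the expression
g_{ap} Γ^p_{db} of the same inner product (`e2`). -/
theorem sum_mul_pderiv_christoffel (h : IsImmersionOn G W F g U) (hu : u ∈ U) (a b c d : Fin n) :
    ∑ p, g u a p * (pderiv c (christoffel g p d b) u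
        + ∑ q, christoffel g p c q u * christoffel g q d b u) =
      bil (G (F u)) (covd G F c (covd G F d (tang F b)) u) (tang F a u)
        + normalBil G F g u (covd G F c (tang F a) u) (covd G F d (tang F b) u) := by
  have hs := h.target.symm (F u) (h.mapsTo u hu)
  have e1 : pderiv c (fun z ↦ bil (G (F z)) (covd G F d (tang F b) z) (tang F a z)) u =
      bil (G (F u)) (covd G F c (covd G F d (tang F b)) u) (tang F a u)
        + bil (G (F u)) (covd G F c (tang F a) u) (covd G F d (tang F b) u) := by
    rw [h.pderiv_bil hu (h.smooth_covd (h.smooth_tang b) d) (h.smooth_tang a),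
      bil_symm hs (covd G F d (tang F b) u)]
  have e2 : pderiv c (fun z ↦ bil (G (F z)) (covd G F d (tang F b) z) (tang F a z)) u =
      ∑ p, pderiv c (fun z ↦ g z a p) u * christoffel g p d b u
        + ∑ p, g u a p * pderiv c (christoffel g p d b) u := by
    rw [pderiv_congr_on h.source.isOpen hu (fun z hz ↦ h.bil_covd_tang hz d b a),
      pderiv_sum _ fun p _ ↦ h.diffAt hu
        ((h.source.smooth a p).mul (h.source.contDiffOn_christoffel p d b)),
      ← Finset.sum_add_distrib]
    exact Finset.sum_congr rfl fun p _ ↦ pderiv_mul (h.diffAt hu (h.source.smooth a p))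
      (h.diffAt hu (h.source.contDiffOn_christoffel p d b)) c
  -- Of the two parts of ∂_c g_{ap}, one gives the quadratic Christoffel term of the curvature of
  -- `g`; the other, by `e4`, is the product of tangential parts subtracted in `normalBil`.
  have e3 : ∑ p, pderiv c (fun z ↦ g z a p) u * christoffel g p d b u =
      ∑ p, bil (G (F u)) (covd G F c (tang F a) u) (tang F p u) * christoffel g p d b u
        + ∑ p, g u a p * ∑ q, christoffel g p c q u * christoffel g q d b u := by
    simp only [h.pderiv_metric hu, add_mul, Finset.sum_add_distrib]
    congr 1
    simp only [h.bil_covd_tang hu, Finset.sum_mul, Finset.mul_sum]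
    rw [Finset.sum_comm]
    exact Finset.sum_congr rfl fun _ _ ↦ Finset.sum_congr rfl fun _ _ ↦ by ring
  have e4 : ∑ p, bil (G (F u)) (covd G F c (tang F a) u) (tang F p u) * christoffel g p d b u =
      ∑ e, ∑ f, (g u)⁻¹ e f * bil (G (F u)) (covd G F c (tang F a) u) (tang F e u)
        * bil (G (F u)) (covd G F d (tang F b) u) (tang F f u) := by
    simp only [h.christoffel_eq hu, Finset.mul_sum]
    exact Finset.sum_congr rfl fun _ _ ↦ Finset.sum_congr rfl fun _ _ ↦ by ring
  simp only [mul_add, Finset.sum_add_distrib, normalBil]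
  linarith

/-- The commutator of covariant derivatives along `F` is the curvature. -/
theorem covd_covd_sub (h : IsImmersionOn G W F g U) (hu : u ∈ U) (b c d : Fin n) (i : Fin m) :
    covd G F c (covd G F d (tang F b)) u i - covd G F d (covd G F c (tang F b)) u i =
      ∑ j, ∑ k, ∑ l, riemannUp G i j k l (F u) * tang F b u j * tang F c u k * tang F d u l := by
  have hΓ : ∀ i l q, ContDiffOn ℝ ∞ (fun z ↦ christoffel G i l q (F z)) U := fun i l q ↦
    h.smooth_comp (h.target.contDiffOn_christoffel i l q)
  -- The summands are arranged so that everything before the last one is symmetric in `c` and `d`,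
  -- and only the last survives in the commutator.
  have key : ∀ c d, covd G F c (covd G F d (tang F b)) u i =
      pderiv c (fun z ↦ pderiv d (fun z ↦ tang F b z i) z) u
      + (∑ l, ∑ q, christoffel G i l q (F u) *
          pderiv c (fun z ↦ tang F d z l) u * tang F b u q)
      + ((∑ l, ∑ q, christoffel G i l q (F u) *
          tang F d u l * pderiv c (fun z ↦ tang F b z q) u)
        + (∑ l, ∑ q, christoffel G i l q (F u) *
          tang F c u l * pderiv d (fun z ↦ tang F b z q) u))
      + ∑ j, ∑ k, ∑ l, (pderiv k (christoffel G i l j) (F u)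
          + ∑ p, christoffel G i k p (F u) * christoffel G p l j (F u))
          * tang F b u j * tang F c u k * tang F d u l := by
    intro c d
    have e1 : pderiv c (fun z ↦ covd G F d (tang F b) z i) u =
        pderiv c (fun z ↦ pderiv d (fun z ↦ tang F b z i) z) u
        + ∑ l, ∑ q, ((∑ k, pderiv k (christoffel G i l q) (F u) * tang F c u k)
            * tang F d u l * tang F b u q
          + christoffel G i l q (F u) * pderiv c (fun z ↦ tang F d z l) u * tang F b u q
          + christoffel G i l q (F u) * tang F d u l * pderiv c (fun z ↦ tang F b z q) u) := by
      unfold covd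
      rw [pderiv_add (h.diffAt hu (contDiffOn_pderiv h.source.isOpen (h.smooth_tang b i) d))
        (h.diffAt hu (ContDiffOn.sum fun l _ ↦ ContDiffOn.sum fun q _ ↦
          ((hΓ i l q).mul (h.smooth_tang d l)).mul (h.smooth_tang b q))),
        pderiv_sum _ fun l _ ↦ h.diffAt hu (ContDiffOn.sum fun q _ ↦
          ((hΓ i l q).mul (h.smooth_tang d l)).mul (h.smooth_tang b q))]
      congr 1
      refine Finset.sum_congr rfl fun l _ ↦ ?_
      rw [pderiv_sum _ fun q _ ↦ h.diffAt hu
          (((hΓ i l q).mul (h.smooth_tang d l)).mul (h.smooth_tang b q))]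
      refine Finset.sum_congr rfl fun q _ ↦ ?_
      rw [pderiv_mul (h.diffAt hu ((hΓ i l q).mul (h.smooth_tang d l)))
          (h.diffAt hu (h.smooth_tang b q)),
        pderiv_mul (h.diffAt hu (hΓ i l q)) (h.diffAt hu (h.smooth_tang d l)),
        h.pderiv_pullback hu (h.target.contDiffOn_christoffel i l q)]
      ring
    have e2 : ∑ l, ∑ q, (∑ k, pderiv k (christoffel G i l q) (F u) * tang F c u k)
            * tang F d u l * tang F b u q = ∑ j, ∑ k, ∑ l, pderiv k (christoffel G i l j) (F u)
          * tang F b u j * tang F c u k * tang F d u l := by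
      rw [Finset.sum_comm]
      refine Finset.sum_congr rfl fun j _ ↦ ?_
      rw [Finset.sum_comm (s := (Finset.univ : Finset (Fin m)))]
      refine Finset.sum_congr rfl fun l _ ↦ ?_
      simp only [Finset.sum_mul]
      exact Finset.sum_congr rfl fun _ _ ↦ by ring
    have e3 : ∑ l, ∑ q, christoffel G i l q (F u) * tang F c u l * covd G F d (tang F b) u q =
        (∑ l, ∑ q, christoffel G i l q (F u) *
          tang F c u l * pderiv d (fun z ↦ tang F b z q) u)
        + ∑ j, ∑ k, ∑ l, (∑ p, christoffel G i k p (F u) * christoffel G p l j (F u))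
          * tang F b u j * tang F c u k * tang F d u l := by
      simp only [covd, mul_add, Finset.sum_add_distrib]
      congr 1
      simp only [Finset.sum_mul, Finset.mul_sum]
      conv_rhs => rw [Finset.sum_comm]
      refine Finset.sum_congr rfl fun k _ ↦ ?_
      rw [sum_reverse]
      exact Finset.sum_congr rfl fun _ _ ↦ Finset.sum_congr rfl fun _ _ ↦
        Finset.sum_congr rfl fun _ _ ↦ by ring
    rw [covd, e1, e3]
    simp only [Finset.sum_add_distrib, add_mul, e2]
    ring
  have e5 : pderiv c (fun z ↦ pderiv d (fun z ↦ tang F b z i) z) u =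
      pderiv d (fun z ↦ pderiv c (fun z ↦ tang F b z i) z) u :=
    pderiv_comm h.source.isOpen hu (h.smooth_tang b i) c d
  have e6 : ∑ j, ∑ k, ∑ l, (pderiv k (christoffel G i l j) (F u)
          + ∑ p, christoffel G i k p (F u) * christoffel G p l j (F u))
          * tang F b u j * tang F d u k * tang F c u l =
      ∑ j, ∑ k, ∑ l, (pderiv l (christoffel G i k j) (F u)
          + ∑ p, christoffel G i l p (F u) * christoffel G p k j (F u))
          * tang F b u j * tang F c u k * tang F d u l := by
    refine Finset.sum_congr rfl fun j _ ↦ ?_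
    rw [Finset.sum_comm]
    exact Finset.sum_congr rfl fun _ _ ↦ Finset.sum_congr rfl fun _ _ ↦ by ring
  have e7 : ∑ j, ∑ k, ∑ l, riemannUp G i j k l (F u) * tang F b u j * tang F c u k * tang F d u l
      = ∑ j, ∑ k, ∑ l, (pderiv k (christoffel G i l j) (F u)
          + ∑ p, christoffel G i k p (F u) * christoffel G p l j (F u))
          * tang F b u j * tang F c u k * tang F d u l
        - ∑ j, ∑ k, ∑ l, (pderiv l (christoffel G i k j) (F u)
          + ∑ p, christoffel G i l p (F u) * christoffel G p k j (F u))
          * tang F b u j * tang F c u k * tang F d u l := by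
    simp only [riemannUp, ← Finset.sum_sub_distrib]
    refine Finset.sum_congr rfl fun j _ ↦ Finset.sum_congr rfl fun k _ ↦
      Finset.sum_congr rfl fun l _ ↦ ?_
    rw [Finset.sum_sub_distrib]
    ring
  rw [key c d, key d c, e5, e6, e7]
  simp only [h.tang_comm hu d c]
  ring

/-- The Gauss equation in coordinates. -/
theorem riemann_eq (h : IsImmersionOn G W F g U) (hu : u ∈ U) (a b c d : Fin n) :
    riemann g a b c d u =
      (∑ i, ∑ j, ∑ k, ∑ l, riemann G i j k l (F u) * tang F a u i * tang F b u j
        * tang F c u k * tang F d u l)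
      + normalBil G F g u (covd G F c (tang F a) u) (covd G F d (tang F b) u)
      - normalBil G F g u (covd G F d (tang F a) u) (covd G F c (tang F b) u) := by
  have e1 : riemann g a b c d u =
      ∑ p, g u a p * (pderiv c (christoffel g p d b) u
        + ∑ q, christoffel g p c q u * christoffel g q d b u)
      - ∑ p, g u a p * (pderiv d (christoffel g p c b) u
        + ∑ q, christoffel g p d q u * christoffel g q c b u) := by
    rw [riemann, ← Finset.sum_sub_distrib]
    refine Finset.sum_congr rfl fun p _ ↦ ?_
    rw [riemannUp, Finset.sum_sub_distrib]
    ring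
  have e2 : bil (G (F u)) (covd G F c (covd G F d (tang F b)) u) (tang F a u)
      - bil (G (F u)) (covd G F d (covd G F c (tang F b)) u) (tang F a u) =
      ∑ i, ∑ j, ∑ k, ∑ l, riemann G i j k l (F u) * tang F a u i * tang F b u j
        * tang F c u k * tang F d u l := by
    rw [← bil_sub_left, bil_symm (h.target.symm _ (h.mapsTo u hu))]
    unfold bil
    refine Finset.sum_congr rfl fun i _ ↦ ?_
    simp only [Pi.sub_apply, h.covd_covd_sub hu, riemann, Finset.mul_sum, Finset.sum_mul]
    rw [Finset.sum_comm]
    refine Finset.sum_congr rfl fun j _ ↦ ?_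
    rw [Finset.sum_comm]
    refine Finset.sum_congr rfl fun k _ ↦ ?_
    rw [Finset.sum_comm]
    exact Finset.sum_congr rfl fun _ _ ↦ Finset.sum_congr rfl fun _ _ ↦ by ring
  rw [e1, h.sum_mul_pderiv_christoffel hu, h.sum_mul_pderiv_christoffel hu, ← e2]
  ring

theorem bil_tang_sum (h : IsImmersionOn G W F g U) (hu : u ∈ U) (b : Fin n) (c : Fin n → ℝ) :
    bil (G (F u)) (tang F b u) (fun i ↦ ∑ a, tang F a u i * c a) = ∑ a, g u b a * c a := by
  simp only [h.pullback u hu, bil, Finset.mul_sum, Finset.sum_mul]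
  conv_rhs => rw [Finset.sum_comm]
  refine Finset.sum_congr rfl fun i _ ↦ ?_
  conv_rhs => rw [Finset.sum_comm]
  exact Finset.sum_congr rfl fun _ _ ↦ Finset.sum_congr rfl fun _ _ ↦ by ring

/-- The ∂_a F are linearly independent because `g` is nondegenerate: the coefficients are recovered
by pairing with the ∂_b F and applying the inverse of `g`. -/
theorem eq_of_sum_tang_eq (h : IsImmersionOn G W F g U) (hu : u ∈ U) {c c' : Fin n → ℝ}
    (hc : ∀ i, ∑ a, tang F a u i * c a = ∑ a, tang F a u i * c' a) (a : Fin n) : c a = c' a := by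
  have key : ∀ c : Fin n → ℝ, c a = ∑ b, (g u)⁻¹ a b *
      bil (G (F u)) (tang F b u) (fun i ↦ ∑ a, tang F a u i * c a) := by
    intro c
    simp only [h.bil_tang_sum hu]
    calc c a = ∑ k, (∑ b, (g u)⁻¹ a b * g u b k) * c k := by simp [h.inv_mul_metric hu]
      _ = _ := by
        simp only [Finset.mul_sum, Finset.sum_mul]
        rw [Finset.sum_comm]
        exact Finset.sum_congr rfl fun _ _ ↦ Finset.sum_congr rfl fun _ _ ↦ by ring
  rw [key c, key c', funext hc]

end IsImmersionOn

end Along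

/-! ### Hadamard's lemma -/

-- The integral is the value at 0 of the convolution of the indicator of [0, 1] with s ↦ χ(s) f(p,
-- −s), so smoothness in `p` follows from that of convolutions with parameters.
open MeasureTheory in
theorem contDiff_setIntegral_Icc {P : Type*} [NormedAddCommGroup P] [NormedSpace ℝ P]
    {f : P → ℝ → ℝ} (hf : ContDiff ℝ ∞ (fun q : P × ℝ ↦ f q.1 q.2)) :
    ContDiff ℝ ∞ (fun p ↦ ∫ t in Set.Icc (0 : ℝ) 1, f p t) := by
  -- The cutoff is 1 on [−1, 1], where it must not alter the integrand, and vanishes outside [−2,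
  -- 2], which gives the compact support.
  let χ : ContDiffBump (0 : ℝ) := ⟨1, 2, one_pos, one_lt_two⟩
  have h := contDiffOn_convolution_right_with_param_comp (𝕜 := ℝ) (n := ⊤) (μ := volume)
    (ContinuousLinearMap.mul ℝ ℝ) (s := (Set.univ : Set P)) (v := fun _ ↦ (0 : ℝ))
    contDiffOn_const (f := Set.indicator (Set.Icc (0 : ℝ) 1) fun _ ↦ (1 : ℝ))
    (g := fun p s ↦ χ s * f p (-s)) (k := Metric.closedBall 0 2) isOpen_univ
    (isCompact_closedBall _ _)
    (fun p s _ hs ↦ by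
      have : χ s = 0 := χ.zero_of_le_dist
        (not_le.1 fun h ↦ hs (Metric.mem_closedBall.2 h)).le
      simp [this])
    ((integrable_indicator_iff measurableSet_Icc).2
      (integrableOn_const (by simp))).locallyIntegrable
    (by
      have h1 : ContDiff ℝ ∞ (fun q : P × ℝ ↦ χ q.2 * f q.1 (-q.2)) :=
        (χ.contDiff.comp contDiff_snd).mul (hf.comp (contDiff_fst.prodMk contDiff_snd.neg))
      exact h1.contDiffOn)
  rw [contDiffOn_univ] at h
  convert! h using 2 with p
  rw [convolution, ← integral_indicator measurableSet_Icc]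
  refine integral_congr_ae (Filter.Eventually.of_forall fun t ↦ ?_)
  by_cases ht : t ∈ Set.Icc (0 : ℝ) 1
  · have : χ (-t) = 1 := χ.one_of_mem_closedBall (by
      simpa [abs_of_nonneg ht.1] using ht.2)
    simp [ht, this]
  · simp [ht]

/-- The fundamental theorem of calculus along the segment from `u₀` to `u`; `h a` is the average of
∂_a f over this segment. -/
theorem exists_eq_add_sum_mul {n : ℕ} {f : Coord n → ℝ} (hf : ContDiff ℝ ∞ f) (u₀ : Coord n) :
    ∃ h : Fin n → Coord n → ℝ, (∀ a, ContDiff ℝ ∞ (h a)) ∧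
      ∀ u, f u = f u₀ + ∑ a, (u a - u₀ a) * h a u := by
  have hs : ∀ a, ContDiff ℝ ∞ (fun q : Coord n × ℝ ↦ pderiv a f (u₀ + q.2 • (q.1 - u₀))) := by
    intro a
    have h1 : ContDiff ℝ ∞ (pderiv a f) :=
      (hf.fderiv_right (m := ∞) (by simp)).clm_apply contDiff_const
    exact h1.comp (contDiff_const.add (contDiff_snd.smul (contDiff_fst.sub contDiff_const)))
  refine ⟨fun a u ↦ ∫ t in Set.Icc (0 : ℝ) 1, pderiv a f (u₀ + t • (u - u₀)),
    fun a ↦ contDiff_setIntegral_Icc (hs a), fun u ↦ ?_⟩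
  have hc : ∀ a, Continuous fun t : ℝ ↦ pderiv a f (u₀ + t • (u - u₀)) := fun a ↦
    (hs a).continuous.comp (Continuous.prodMk continuous_const continuous_id)
  have hd : ∀ t ∈ Set.uIcc (0 : ℝ) 1, HasDerivAt (fun t : ℝ ↦ f (u₀ + t • (u - u₀)))
      (∑ a, (u a - u₀ a) * pderiv a f (u₀ + t • (u - u₀))) t := by
    intro t _
    have h1 : HasDerivAt (fun t : ℝ ↦ u₀ + t • (u - u₀)) (u - u₀) t := by
      simpa using ((hasDerivAt_id t).smul_const (u - u₀)).const_add u₀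
    have h2 := ((hf.differentiable (by simp) _).hasFDerivAt).comp_hasDerivAt t h1
    refine h2.congr_deriv ?_
    rw [fderiv_eq_sum_pderiv]
    exact Finset.sum_congr rfl fun a _ ↦ by simp [mul_comm]
  have hint := intervalIntegral.integral_eq_sub_of_hasDerivAt hd
    (Continuous.intervalIntegrable (continuous_finsetSum _ fun a _ ↦
      continuous_const.mul (hc a)) _ _)
  rw [intervalIntegral.integral_finsetSum (f := fun a t ↦ (u a - u₀ a) *
    pderiv a f (u₀ + t • (u - u₀))) fun a _ ↦
    (continuous_const.mul (hc a)).intervalIntegrable _ _] at hint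
  simp only [intervalIntegral.integral_const_mul, one_smul, zero_smul, add_zero,
    add_sub_cancel] at hint
  simp only [MeasureTheory.integral_Icc_eq_integral_Ioc,
    ← intervalIntegral.integral_of_le zero_le_one]
  linarith

/-! ### Point derivations -/

section PointDerivation

variable {n : ℕ} {S : Type*} [TopologicalSpace S] [T2Space S]
  [ChartedSpace (EuclideanSpace ℝ (Fin n)) S] [IsManifold (𝓡 n) ∞ S]

theorem exists_bump {O : Set S} (hO : IsOpen O) {p : S} (hp : p ∈ O) :
    ∃ ρ : C^∞⟮𝓡 n, S; ℝ⟯, (∀ᶠ q in 𝓝 p, ρ q = 1) ∧ tsupport ρ ⊆ O := by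
  obtain ⟨ρ, -, hρ⟩ := (SmoothBumpFunction.nhds_basis_tsupport (I := 𝓡 n) p).mem_iff.1
    (hO.mem_nhds hp)
  exact ⟨⟨ρ, ρ.contMDiff⟩, ρ.eventuallyEq_one, hρ⟩

theorem exists_extension {f : S → ℝ} {O : Set S} (hO : IsOpen O) {p : S} (hp : p ∈ O)
    (hf : ContMDiffOn (𝓡 n) 𝓘(ℝ, ℝ) ∞ f O) :
    ∃ F : C^∞⟮𝓡 n, S; ℝ⟯, ∀ᶠ q in 𝓝 p, F q = f q := by
  obtain ⟨ρ, h1, h2⟩ := exists_bump (n := n) hO hp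
  refine ⟨⟨fun q ↦ ρ q * f q, contMDiff_of_tsupport fun q hq ↦ ?_⟩, ?_⟩
  · have hq' : q ∈ O := h2 (tsupport_mul_subset_left hq)
    exact ρ.contMDiff.contMDiffAt.mul (hf.contMDiffAt (hO.mem_nhds hq'))
  · filter_upwards [h1] with q hq
    simp [hq]

theorem extend_eventuallyEq {f : S → ℝ} {O : Set S} (hO : IsOpen O) {p : S} (hp : p ∈ O)
    (hf : ContMDiffOn (𝓡 n) 𝓘(ℝ, ℝ) ∞ f O) :
    ∀ᶠ q in 𝓝 p, (extend f p : C^∞⟮𝓡 n, S; ℝ⟯) q = f q := by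
  have h := exists_extension hO hp hf
  rw [extend, dif_pos h]
  exact h.choose_spec

variable {v : C^∞⟮𝓡 n, S; ℝ⟯ →ₗ[ℝ] ℝ} {p : S}

/-- Locality: for a bump ρ that is 1 near `p` and supported where `f` vanishes, ρ f = 0, and the
Leibniz rule reads 0 = v(f) + 0. -/
theorem pointDerivation_eq_zero (hv : ∀ f g, v (f * g) = f p * v g + g p * v f)
    {f : C^∞⟮𝓡 n, S; ℝ⟯} (hf : ∀ᶠ q in 𝓝 p, f q = 0) : v f = 0 := by
  obtain ⟨O, hO, hOo, hp⟩ := eventually_nhds_iff.1 hf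
  obtain ⟨ρ, h1, h2⟩ := exists_bump (n := n) hOo hp
  have h0 : ρ * f = 0 := by
    ext q
    by_cases hq : q ∈ O
    · simp [hO q hq]
    · have : ρ q = 0 := image_eq_zero_of_notMem_tsupport fun h ↦ hq (h2 h)
      simp [this]
  have := hv ρ f
  rw [h0, map_zero, h1.self_of_nhds, hO p hp] at this
  linarith

omit [T2Space S] [IsManifold (𝓡 n) ∞ S] in
theorem pointDerivation_const (hv : ∀ f g, v (f * g) = f p * v g + g p * v f) (c : ℝ) :
    v (algebraMap ℝ _ c) = 0 := by
  have h1 : v 1 = 0 := by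
    have := hv 1 1
    simp only [mul_one, ContMDiffMap.coe_one, Pi.one_apply, one_mul] at this
    linarith
  rw [Algebra.algebraMap_eq_smul_one, map_smul, h1, smul_zero]

/-- A derivation at a point is a combination of the partial derivatives. -/
theorem pointDerivation_eq_sum (hv : ∀ f g, v (f * g) = f p * v g + g p * v f)
    {ψ : OpenPartialHomeomorph S (EuclideanSpace ℝ (Fin n))}
    (hψ : ψ ∈ IsManifold.maximalAtlas (𝓡 n) ∞ S) (hp : p ∈ ψ.source) (f : C^∞⟮𝓡 n, S; ℝ⟯) :
    v f = ∑ a, pderiv a (fun u ↦ f (ψ.symm u)) (ψ p) * v (extend (fun q ↦ ψ q a) p) := by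
  have hψs := contMDiffOn_of_mem_maximalAtlas hψ
  have hψt := contMDiffOn_symm_of_mem_maximalAtlas hψ
  have hfs : ContMDiffOn (𝓡 n) 𝓘(ℝ, ℝ) ∞ (fun u ↦ f (ψ.symm u)) ψ.target :=
    f.contMDiff.comp_contMDiffOn hψt
  -- Hadamard's lemma integrates along segments, so it needs a function on all of ℝ^n; `f'` agrees
  -- with f ∘ ψ⁻¹ only near ψ(p).
  obtain ⟨f', hf'⟩ := exists_extension ψ.open_target (ψ.map_source hp) hfs
  obtain ⟨h, hh, hsum⟩ := exists_eq_add_sum_mul f'.contMDiff.contDiff (ψ p)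
  have hH : ∀ a, ContMDiffOn (𝓡 n) 𝓘(ℝ, ℝ) ∞ (fun q ↦ h a (ψ q)) ψ.source := fun a ↦
    (hh a).contMDiff.comp_contMDiffOn hψs
  have hU : ∀ a, ContMDiffOn (𝓡 n) 𝓘(ℝ, ℝ) ∞ (fun q ↦ ψ q a) ψ.source := fun a ↦
    (EuclideanSpace.proj a : Coord n →L[ℝ] ℝ).contMDiff.comp_contMDiffOn hψs
  have eH := fun a ↦ extend_eventuallyEq ψ.open_source hp (hH a)
  have eU := fun a ↦ extend_eventuallyEq ψ.open_source hp (hU a)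
  set H : Fin n → C^∞⟮𝓡 n, S; ℝ⟯ := fun a ↦ extend (fun q ↦ h a (ψ q)) p
  set Z : Fin n → C^∞⟮𝓡 n, S; ℝ⟯ := fun a ↦ extend (fun q ↦ ψ q a) p
  have hf0 : f' (ψ p) = f p := by
    rw [hf'.self_of_nhds, ψ.left_inv hp]
  -- Pulled back to the manifold, Hadamard's expansion holds only near `p`; by locality this
  -- suffices for `v`.
  have hzero : v (f - (algebraMap ℝ _ (f p)
      + ∑ a, (Z a - algebraMap ℝ _ (ψ p a)) * H a)) = 0 := by
    refine pointDerivation_eq_zero hv ?_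
    have hc : ∀ᶠ q in 𝓝 p, f' (ψ q) = f (ψ.symm (ψ q)) := (ψ.continuousAt hp).eventually hf'
    filter_upwards [hc, ψ.open_source.mem_nhds hp, Filter.eventually_all.2 eH,
      Filter.eventually_all.2 eU] with q h1 h2 h3 h4
    rw [ψ.left_inv h2, hsum, hf0] at h1
    have e : ∀ a, (Z a - algebraMap ℝ _ (ψ p a) : C^∞⟮𝓡 n, S; ℝ⟯) q * H a q
        = (ψ q a - ψ p a) * h a (ψ q) := fun a ↦ by
      rw [← h3 a, ← h4 a]
      rfl
    have e2 : (f - (algebraMap ℝ _ (f p)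
        + ∑ a, (Z a - algebraMap ℝ _ (ψ p a)) * H a) : C^∞⟮𝓡 n, S; ℝ⟯) q = f q - (f p +
        ∑ a, (Z a - algebraMap ℝ _ (ψ p a) : C^∞⟮𝓡 n, S; ℝ⟯) q * H a q) := by
      have e3 := map_sum (ContMDiffMap.evalRingHom q : C^∞⟮𝓡 n, S; ℝ⟯ →+* ℝ)
        (fun a ↦ (Z a - algebraMap ℝ _ (ψ p a)) * H a) Finset.univ
      exact congrArg (fun r ↦ f q - (f p + r)) e3
    rw [e2, ← h1]
    simp only [e]
    ring
  have hpd : ∀ a, pderiv a (fun u ↦ f (ψ.symm u)) (ψ p) = h a (ψ p) := by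
    intro a
    have hd : ∀ a u, DifferentiableAt ℝ (h a) u := fun a u ↦
      ((hh a).differentiable (by simp)).differentiableAt
    have hd' : ∀ a u, DifferentiableAt ℝ (fun z : Coord n ↦ z a - ψ p a) u := fun a u ↦
      ((EuclideanSpace.proj a : Coord n →L[ℝ] ℝ).differentiableAt).sub_const _
    have hd'' : ∀ a u, DifferentiableAt ℝ (fun z : Coord n ↦ (z a - ψ p a) * h a z) u :=
      fun a u ↦ (hd' a u).mul (hd a u)
    rw [← pderiv_congr hf', funext hsum,
      pderiv_add (differentiableAt_const _) (DifferentiableAt.fun_sum fun a _ ↦ hd'' a _),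
      pderiv_const, pderiv_sum _ fun a _ ↦ hd'' a _]
    simp [pderiv_mul (hd' _ _) (hd _ _), pderiv_coord]
  rw [map_sub, map_add, pointDerivation_const hv, map_sum] at hzero
  -- The first factor vanishes at `p`, so only its derivative contributes.
  have : ∀ a, v ((Z a - algebraMap ℝ _ (ψ p a)) * H a) = h a (ψ p) * v (Z a) := by
    intro a
    rw [hv, map_sub, pointDerivation_const hv]
    have e1 : (Z a - algebraMap ℝ _ (ψ p a) : C^∞⟮𝓡 n, S; ℝ⟯) p = 0 := by
      change Z a p - ψ p a = 0
      rw [(eU a).self_of_nhds, sub_self]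
    rw [e1, (eH a).self_of_nhds]
    ring
  simp only [this] at hzero
  simp only [hpd]
  linarith

end PointDerivation

/-! ### Components of a metric in a chart -/

section Chart

variable {m : ℕ} {M : Type*} [TopologicalSpace M] [ChartedSpace (EuclideanSpace ℝ (Fin m)) M]
  [IsManifold (𝓡 m) ∞ M] {φ : OpenPartialHomeomorph M (EuclideanSpace ℝ (Fin m))}

omit [IsManifold (𝓡 m) ∞ M] in
theorem mdifferentiable_of_mem_maximalAtlas (hφ : φ ∈ IsManifold.maximalAtlas (𝓡 m) ∞ M) :
    φ.MDifferentiable (𝓡 m) (𝓡 m) :=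
  ⟨(contMDiffOn_of_mem_maximalAtlas hφ).mdifferentiableOn (by simp),
    (contMDiffOn_symm_of_mem_maximalAtlas hφ).mdifferentiableOn (by simp)⟩

theorem contMDiffOn_coordVec (hφ : φ ∈ IsManifold.maximalAtlas (𝓡 m) ∞ M) (i : Fin m) :
    ContMDiffOn (𝓡 m) (𝓡 m).tangent ∞
      (fun y ↦ (⟨φ.symm y, coordVec φ i y⟩ : TangentBundle (𝓡 m) M)) φ.target := by
  have h1 := (contMDiffOn_symm_of_mem_maximalAtlas hφ).contMDiffOn_tangentMapWithin (m := ∞)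
    (by simp) φ.open_target.uniqueMDiffOn
  have h2 : ContMDiffOn (𝓡 m) (𝓡 m).tangent ∞ (fun y : EuclideanSpace ℝ (Fin m) ↦
      (⟨y, EuclideanSpace.single i (1 : ℝ)⟩ : TangentBundle (𝓡 m) (EuclideanSpace ℝ (Fin m))))
      φ.target :=
    contMDiffOn_vectorSpace_iff_contDiffOn.2 contDiffOn_const
  refine (h1.comp h2 fun y hy ↦ hy).congr fun y hy ↦ ?_
  simp only [Function.comp, tangentMapWithin, coordVec,
    mfderivWithin_of_mem_nhds (φ.open_target.mem_nhds hy)]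

theorem contDiffOn_metricMatrix (η : PseudoRiemannianMetric m M)
    (hφ : φ ∈ IsManifold.maximalAtlas (𝓡 m) ∞ M) (i j : Fin m) :
    ContDiffOn ℝ ∞ (fun y ↦ metricMatrix η φ y i j) φ.target := by
  rw [← contMDiffOn_iff_contDiffOn]
  intro y hy
  have : ContMDiffWithinAt (𝓡 m) ((𝓡 m).prod 𝓘(ℝ)) ∞
      (fun y ↦ Bundle.TotalSpace.mk' ℝ (E := Bundle.Trivial M ℝ) (φ.symm y)
        (η.form (φ.symm y) (coordVec φ i y) (coordVec φ j y))) φ.target y := by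
    apply ContMDiffWithinAt.clm_bundle_apply₂ (F₁ := EuclideanSpace ℝ (Fin m))
      (F₂ := EuclideanSpace ℝ (Fin m))
    · exact ContMDiffAt.comp_contMDiffWithinAt y η.contMDiff.contMDiffAt
        (contMDiffOn_symm_of_mem_maximalAtlas hφ y hy)
    · exact contMDiffOn_coordVec hφ i y hy
    · exact contMDiffOn_coordVec hφ j y hy
  simp only [Bundle.contMDiffWithinAt_totalSpace] at this
  exact this.2

theorem form_mfderiv_symm (η : PseudoRiemannianMetric m M) (y : EuclideanSpace ℝ (Fin m))
    (v w : EuclideanSpace ℝ (Fin m)) :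
    η.form (φ.symm y) (mfderiv (𝓡 m) (𝓡 m) φ.symm y v) (mfderiv (𝓡 m) (𝓡 m) φ.symm y w) =
      bil (metricMatrix η φ y) v w := by
  have hexp : ∀ v : EuclideanSpace ℝ (Fin m), mfderiv (𝓡 m) (𝓡 m) φ.symm y v =
      ∑ i, v i • coordVec φ i y := by
    intro v
    conv_lhs => rw [← (EuclideanSpace.basisFun (Fin m) ℝ).sum_repr v]
    erw [map_sum]
    refine Finset.sum_congr rfl fun i _ ↦ ?_
    erw [map_smul]
    simp [coordVec]
  rw [hexp, hexp]
  simp only [map_sum, map_smul, sum_apply, smul_apply, bil,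
    smul_eq_mul, Finset.mul_sum, metricMatrix, Matrix.of_apply]
  rw [Finset.sum_comm]
  exact Finset.sum_congr rfl fun _ _ ↦ Finset.sum_congr rfl fun _ _ ↦ by ring

/-- All tangent spaces are by definition the model space, so the same vector can be read at `p` and
at `q`. This is needed because φ⁻¹(φ(p)) equals `p` only propositionally. -/
theorem form_eq_of_eq (η : PseudoRiemannianMetric m M) {p q : M} (h : p = q)
    (v w : EuclideanSpace ℝ (Fin m)) :
    η.form p (v : TangentSpace (𝓡 m) p) (w : TangentSpace (𝓡 m) p) =
      η.form q (v : TangentSpace (𝓡 m) q) (w : TangentSpace (𝓡 m) q) := by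
  subst h
  rfl

omit [IsManifold (𝓡 m) ∞ M] in
theorem mfderiv_symm_mfderiv (hφ : φ ∈ IsManifold.maximalAtlas (𝓡 m) ∞ M) {p : M}
    (hp : p ∈ φ.source) (X : TangentSpace (𝓡 m) p) :
    (mfderiv (𝓡 m) (𝓡 m) φ.symm (φ p) (mfderiv (𝓡 m) (𝓡 m) φ p X) : EuclideanSpace ℝ (Fin m))
      = X :=
  congrArg (fun L : EuclideanSpace ℝ (Fin m) →L[ℝ] EuclideanSpace ℝ (Fin m) ↦ L X)
    ((mdifferentiable_of_mem_maximalAtlas hφ).symm_comp_deriv hp)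

omit [IsManifold (𝓡 m) ∞ M] in
theorem mfderiv_mfderiv_symm (hφ : φ ∈ IsManifold.maximalAtlas (𝓡 m) ∞ M)
    {y : EuclideanSpace ℝ (Fin m)} (hy : y ∈ φ.target) (v : EuclideanSpace ℝ (Fin m)) :
    (mfderiv (𝓡 m) (𝓡 m) φ (φ.symm y) (mfderiv (𝓡 m) (𝓡 m) φ.symm y v) :
      EuclideanSpace ℝ (Fin m)) = v :=
  congrArg (fun L : EuclideanSpace ℝ (Fin m) →L[ℝ] EuclideanSpace ℝ (Fin m) ↦ L v)
    ((mdifferentiable_of_mem_maximalAtlas hφ).comp_symm_deriv hy)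

theorem form_eq_bil (η : PseudoRiemannianMetric m M)
    (hφ : φ ∈ IsManifold.maximalAtlas (𝓡 m) ∞ M) {p : M} (hp : p ∈ φ.source)
    (X Y : TangentSpace (𝓡 m) p) :
    η.form p X Y = bil (metricMatrix η φ (φ p)) (comp φ p X) (comp φ p Y) := by
  have h := form_mfderiv_symm (φ := φ) η (φ p) (mfderiv (𝓡 m) (𝓡 m) φ p X)
    (mfderiv (𝓡 m) (𝓡 m) φ p Y)
  refine Eq.trans ?_ h
  have e1 := mfderiv_symm_mfderiv hφ hp X
  have e2 := mfderiv_symm_mfderiv hφ hp Y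
  refine (form_eq_of_eq η (φ.left_inv hp).symm X Y).trans ?_
  conv_lhs => rw [← e1, ← e2]

theorem isMetricOn_metricMatrix (η : PseudoRiemannianMetric m M)
    (hφ : φ ∈ IsManifold.maximalAtlas (𝓡 m) ∞ M) : IsMetricOn (metricMatrix η φ) φ.target where
  isOpen := φ.open_target
  smooth := contDiffOn_metricMatrix η hφ
  symm y _ i j := η.symm _ _ _
  isUnit y hy := by
    rw [isUnit_iff_ne_zero]
    intro hdet
    -- A kernel vector of the matrix gives a tangent vector orthogonal to everything, which
    -- nondegeneracy forces to be zero.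
    obtain ⟨v, hv0, hv⟩ := Matrix.exists_mulVec_eq_zero_iff.2 hdet
    apply hv0
    have hsym : ∀ i j, metricMatrix η φ y i j = metricMatrix η φ y j i := fun i j ↦ η.symm _ _ _
    have hb : ∀ w, bil (metricMatrix η φ y) v w = 0 := by
      intro w
      rw [bil_symm hsym]
      refine Finset.sum_eq_zero fun i _ ↦ ?_
      have := congrFun hv i
      simp only [Matrix.mulVec, dotProduct, Pi.zero_apply] at this
      calc _ = w i * ∑ j, metricMatrix η φ y i j * v j := by
            rw [Finset.mul_sum]
            exact Finset.sum_congr rfl fun _ _ ↦ by ring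
        _ = 0 := by rw [this, mul_zero]
    have hz : (mfderiv (𝓡 m) (𝓡 m) φ.symm y (WithLp.toLp 2 v)) = 0 := by
      refine η.nondegenerate _ _ fun w ↦ ?_
      have hw : mfderiv (𝓡 m) (𝓡 m) φ.symm y (mfderiv (𝓡 m) (𝓡 m) φ (φ.symm y) w) = w := by
        have := mfderiv_symm_mfderiv hφ (φ.map_target hy) w
        rwa [φ.right_inv hy] at this
      rw [← hw]
      exact (form_mfderiv_symm η y (WithLp.toLp 2 v) _).trans (hb _)
    have := mfderiv_mfderiv_symm hφ hy (WithLp.toLp 2 v)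
    rw [hz] at this
    have h0 : (0 : EuclideanSpace ℝ (Fin m)) = WithLp.toLp 2 v := by
      rw [← this]
      exact (map_zero (mfderiv (𝓡 m) (𝓡 m) φ (φ.symm y))).symm
    funext i
    exact (congrArg (fun z : EuclideanSpace ℝ (Fin m) ↦ z i) h0).symm

end Chart

namespace IsMetricOn

theorem mono {m : ℕ} {G : Coord m → Matrix (Fin m) (Fin m) ℝ} {W W' : Set (Coord m)}
    (h : IsMetricOn G W) (hW' : IsOpen W') (hsub : W' ⊆ W) : IsMetricOn G W' where
  isOpen := hW'
  smooth i j := (h.smooth i j).mono hsub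
  symm z hz := h.symm z (hsub hz)
  isUnit z hz := h.isUnit z (hsub hz)

end IsMetricOn

/-! ### The bracket as a derivation in its first argument -/

theorem Bracket.leibniz_first {n N : ℕ} {S : Type*} [TopologicalSpace S]
    [ChartedSpace (EuclideanSpace ℝ (Fin n)) S] (B : Bracket n N S)
    (Φ : Fin N → C^∞⟮𝓡 n, S; ℝ⟯) (f g : C^∞⟮𝓡 n, S; ℝ⟯) :
    B.toMultilinearMap (Fin.cons (f * g) Φ) =
      f * B.toMultilinearMap (Fin.cons g Φ) + g * B.toMultilinearMap (Fin.cons f Φ) := by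
  simpa using B.leibniz (Fin.cons 0 Φ) 0 f g

/-- The bracket with fixed last arguments, evaluated at a point, as a linear form. -/
def Bracket.evalFirst {n N : ℕ} {S : Type*} [TopologicalSpace S]
    [ChartedSpace (EuclideanSpace ℝ (Fin n)) S] (B : Bracket n N S)
    (Φ : Fin N → C^∞⟮𝓡 n, S; ℝ⟯) (p : S) : C^∞⟮𝓡 n, S; ℝ⟯ →ₗ[ℝ] ℝ where
  toFun f := B.toMultilinearMap (Fin.cons f Φ) p
  map_add' f g := by
    have := B.toMultilinearMap.cons_add Φ f g
    rw [this]
    rfl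
  map_smul' c f := by
    have := B.toMultilinearMap.cons_smul Φ c f
    rw [this]
    rfl

/-! ### The submanifold in coordinates -/

namespace Setting

variable {m n N : ℕ} {M S : Type*}
  [TopologicalSpace M] [ChartedSpace (EuclideanSpace ℝ (Fin m)) M] [IsManifold (𝓡 m) ∞ M]
  [TopologicalSpace S] [ChartedSpace (EuclideanSpace ℝ (Fin n)) S] [IsManifold (𝓡 n) ∞ S]
  (𝒮 : Setting m n N M S)

/-- The immersion in coordinates. -/
def coordMap (u : Coord n) : Coord m := 𝒮.φ (𝒮.ι (𝒮.ψ.symm u))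

/-- The common domain of the coordinates, as a set of `S`. -/
def domain : Set S := 𝒮.ψ.source ∩ 𝒮.ι ⁻¹' 𝒮.φ.source

/-- The common domain of the coordinates, in the coordinates of `S`. -/
def coordDomain : Set (Coord n) := 𝒮.ψ.target ∩ 𝒮.ψ.symm ⁻¹' (𝒮.ι ⁻¹' 𝒮.φ.source)

theorem isOpen_domain : IsOpen 𝒮.domain :=
  𝒮.ψ.open_source.inter (𝒮.φ.open_source.preimage 𝒮.ι_smooth.continuous)

theorem isOpen_coordDomain : IsOpen 𝒮.coordDomain :=
  𝒮.ψ.symm.isOpen_inter_preimage (𝒮.φ.open_source.preimage 𝒮.ι_smooth.continuous)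

variable {𝒮}

theorem mem_coordDomain {p : S} (hp : p ∈ 𝒮.domain) : 𝒮.ψ p ∈ 𝒮.coordDomain :=
  ⟨𝒮.ψ.map_source hp.1, by simpa [𝒮.ψ.left_inv hp.1] using hp.2⟩

theorem symm_mem_domain {u : Coord n} (hu : u ∈ 𝒮.coordDomain) : 𝒮.ψ.symm u ∈ 𝒮.domain :=
  ⟨𝒮.ψ.map_target hu.1, hu.2⟩

theorem contMDiffOn_coordMap : ContMDiffOn (𝓡 n) (𝓡 m) ∞ 𝒮.coordMap 𝒮.coordDomain := by
  have h1 := (contMDiffOn_symm_of_mem_maximalAtlas 𝒮.ψ_mem).mono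
    (Set.inter_subset_left (t := 𝒮.ψ.symm ⁻¹' (𝒮.ι ⁻¹' 𝒮.φ.source)))
  exact (contMDiffOn_of_mem_maximalAtlas 𝒮.φ_mem).comp (𝒮.ι_smooth.comp_contMDiffOn h1)
    fun u hu ↦ hu.2

theorem contMDiffOn_of_coord {f : S → ℝ}
    (hf : ContDiffOn ℝ ∞ (fun u ↦ f (𝒮.ψ.symm u)) 𝒮.coordDomain) :
    ContMDiffOn (𝓡 n) 𝓘(ℝ, ℝ) ∞ f 𝒮.domain := by
  have h1 := (contMDiffOn_of_mem_maximalAtlas 𝒮.ψ_mem).mono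
    (Set.inter_subset_left (t := 𝒮.ι ⁻¹' 𝒮.φ.source))
  refine (hf.contMDiffOn.comp h1 fun p hp ↦ mem_coordDomain hp).congr fun p hp ↦ ?_
  simp [𝒮.ψ.left_inv hp.1]

theorem fderiv_coordMap {u : Coord n} (hu : u ∈ 𝒮.coordDomain) (w : Coord n) :
    fderiv ℝ 𝒮.coordMap u w = mfderiv (𝓡 m) (𝓡 m) 𝒮.φ (𝒮.ι (𝒮.ψ.symm u))
      (mfderiv (𝓡 n) (𝓡 m) 𝒮.ι (𝒮.ψ.symm u) (mfderiv (𝓡 n) (𝓡 n) 𝒮.ψ.symm u w)) := by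
  have h1 : MDifferentiableAt (𝓡 n) (𝓡 n) 𝒮.ψ.symm u :=
    (mdifferentiable_of_mem_maximalAtlas 𝒮.ψ_mem).mdifferentiableAt_symm hu.1
  have h2 : MDifferentiableAt (𝓡 n) (𝓡 m) 𝒮.ι (𝒮.ψ.symm u) :=
    𝒮.ι_smooth.contMDiffAt.mdifferentiableAt (by simp)
  have h3 : MDifferentiableAt (𝓡 m) (𝓡 m) 𝒮.φ (𝒮.ι (𝒮.ψ.symm u)) :=
    (mdifferentiable_of_mem_maximalAtlas 𝒮.φ_mem).mdifferentiableAt hu.2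
  have h := (h3.hasMFDerivAt.comp u (h2.hasMFDerivAt.comp u h1.hasMFDerivAt)).mfderiv
  rw [← mfderiv_eq_fderiv]
  exact congrArg (fun L : Coord n →L[ℝ] Coord m ↦ L w) h

theorem comp_mfderiv {u : Coord n} (hu : u ∈ 𝒮.coordDomain) (w : Coord n) (i : Fin m) :
    comp 𝒮.φ (𝒮.ι (𝒮.ψ.symm u)) (mfderiv (𝓡 n) (𝓡 m) 𝒮.ι (𝒮.ψ.symm u)
      (mfderiv (𝓡 n) (𝓡 n) 𝒮.ψ.symm u w)) i = ∑ a, tang 𝒮.coordMap a u i * w a := by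
  have hd : DifferentiableAt ℝ 𝒮.coordMap u :=
    differentiableAt_of_contDiffOn 𝒮.isOpen_coordDomain hu contMDiffOn_coordMap.contDiffOn
  have h : HasFDerivAt (fun z ↦ 𝒮.coordMap z i)
      ((EuclideanSpace.proj i : Coord m →L[ℝ] ℝ).comp (fderiv ℝ 𝒮.coordMap u)) u :=
    (EuclideanSpace.proj i : Coord m →L[ℝ] ℝ).hasFDerivAt.comp u hd.hasFDerivAt
  have h2 := fderiv_eq_sum_pderiv (u := u) (fun z ↦ 𝒮.coordMap z i) w
  rw [h.fderiv] at h2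
  refine Eq.trans ?_ h2
  exact congrArg (fun z : Coord m ↦ z i) (fderiv_coordMap hu w).symm

theorem isImmersionOn (𝒮 : Setting m n N M S) :
    IsImmersionOn (metricMatrix 𝒮.η 𝒮.φ) 𝒮.φ.target 𝒮.coordMap (metricMatrix 𝒮.g 𝒮.ψ)
      𝒮.coordDomain where
  target := isMetricOn_metricMatrix 𝒮.η 𝒮.φ_mem
  source := (isMetricOn_metricMatrix 𝒮.g 𝒮.ψ_mem).mono 𝒮.isOpen_coordDomain
    Set.inter_subset_left
  smooth := contMDiffOn_coordMap.contDiffOn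
  mapsTo u hu := 𝒮.φ.map_source hu.2
  pullback u hu a b := by
    have key : ∀ a, comp 𝒮.φ (𝒮.ι (𝒮.ψ.symm u))
        (mfderiv (𝓡 n) (𝓡 m) 𝒮.ι (𝒮.ψ.symm u) (coordVec 𝒮.ψ a u)) = tang 𝒮.coordMap a u := by
      intro a
      funext i
      refine (comp_mfderiv hu _ i).trans ?_
      simp
    change 𝒮.g.form _ (coordVec 𝒮.ψ a u) (coordVec 𝒮.ψ b u) = _
    rw [𝒮.induced, form_eq_bil 𝒮.η 𝒮.φ_mem hu.2, key, key]
    rfl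

theorem vec_eq_of_eq {p q : S} (h : p = q) (X : EuclideanSpace ℝ (Fin n)) (i : Fin m) :
    𝒮.vec p (X : TangentSpace (𝓡 n) p) i = 𝒮.vec q (X : TangentSpace (𝓡 n) q) i := by
  subst h
  rfl

theorem vec_eq_sum {p : S} (hp : p ∈ 𝒮.domain) (X : TangentSpace (𝓡 n) p) (i : Fin m) :
    𝒮.vec p X i = ∑ a, tang 𝒮.coordMap a (𝒮.ψ p) i * comp 𝒮.ψ p X a := by
  refine Eq.trans ?_ (comp_mfderiv (mem_coordDomain hp) (mfderiv (𝓡 n) (𝓡 n) 𝒮.ψ p X) i)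
  refine (vec_eq_of_eq (𝒮.ψ.left_inv hp.1).symm X i).trans ?_
  conv_lhs => rw [← mfderiv_symm_mfderiv 𝒮.ψ_mem hp.1 X]
  rfl

/-! ### The derivations D^i in terms of partial derivatives -/

section Derivation

variable [T2Space S] {p : S}

/-- `Bracket.evalFirst` is a derivation at `p`, so `pointDerivation_eq_sum` applies to the extension
of `f`; this has the germ of `f` at `p`, hence the same partial derivatives. -/
theorem brx_eq_sum (hp : p ∈ 𝒮.domain) {f : S → ℝ}
    (hf : ContDiffOn ℝ ∞ (fun u ↦ f (𝒮.ψ.symm u)) 𝒮.coordDomain) (J : Fin N → Fin m) :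
    𝒮.brx f J p = ∑ a, pderiv a (fun u ↦ f (𝒮.ψ.symm u)) (𝒮.ψ p) *
      𝒮.brx (fun q ↦ 𝒮.ψ q a) J p := by
  have hfe := extend_eventuallyEq 𝒮.isOpen_domain hp (contMDiffOn_of_coord hf)
  have hb : ∀ f : S → ℝ, 𝒮.brx f J p =
      𝒮.B.evalFirst (fun r ↦ extend (𝒮.x (J r)) p) p (extend f p) := by
    intro f
    have : (fun k ↦ (extend ((Fin.cons f fun r ↦ 𝒮.x (J r) : Fin (N + 1) → S → ℝ) k) p :
        C^∞⟮𝓡 n, S; ℝ⟯)) = Fin.cons (extend f p) (fun r ↦ extend (𝒮.x (J r)) p) := by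
      funext k
      refine Fin.cases rfl (fun k ↦ rfl) k
    exact congrArg (fun Ψ ↦ 𝒮.B.toMultilinearMap Ψ p) this
  simp only [hb]
  rw [pointDerivation_eq_sum (fun f g ↦ ?_) 𝒮.ψ_mem hp.1 (extend f p)]
  · refine Finset.sum_congr rfl fun a _ ↦ ?_
    congr 1
    refine pderiv_congr ?_ a
    have hc := 𝒮.ψ.continuousAt_symm (𝒮.ψ.map_source hp.1)
    rw [ContinuousAt, 𝒮.ψ.left_inv hp.1] at hc
    exact hc.eventually hfe
  · have := 𝒮.B.leibniz_first (fun r ↦ extend (𝒮.x (J r)) p) f g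
    exact congrArg (fun F : C^∞⟮𝓡 n, S; ℝ⟯ ↦ F p) this

theorem Dder_eq_sum (hp : p ∈ 𝒮.domain) {f : S → ℝ}
    (hf : ContDiffOn ℝ ∞ (fun u ↦ f (𝒮.ψ.symm u)) 𝒮.coordDomain) (i : Fin m) :
    𝒮.Dder i f p = ∑ a, pderiv a (fun u ↦ f (𝒮.ψ.symm u)) (𝒮.ψ p) *
      𝒮.Dder i (fun q ↦ 𝒮.ψ q a) p := by
  simp only [Dder, brx_eq_sum hp hf, Finset.mul_sum, Finset.sum_mul]
  conv_rhs => rw [Finset.sum_comm]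
  refine Finset.sum_congr rfl fun I _ ↦ ?_
  conv_rhs => rw [Finset.sum_comm]
  exact Finset.sum_congr rfl fun I _ ↦ Finset.sum_congr rfl fun I _ ↦ by ring

omit [T2Space S] in
theorem D_eq_Dder (i j : Fin m) : 𝒮.D i j p = 𝒮.Dder i (𝒮.x j) p := by
  have hs : (1 / Real.sqrt (N.factorial)) * (1 / Real.sqrt (N.factorial)) =
      1 / (N.factorial : ℝ) := by
    rw [div_mul_div_comm, Real.mul_self_sqrt (Nat.cast_nonneg _), one_mul]
  simp only [D, Dder, P, Finset.mul_sum]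
  refine Finset.sum_congr rfl fun I _ ↦ Finset.sum_congr rfl fun J _ ↦ ?_
  calc _ = 𝒮.ε / 𝒮.γ p ^ 2 * ((1 / Real.sqrt (N.factorial)) * (1 / Real.sqrt (N.factorial))) *
        (𝒮.brx (𝒮.x i) I p * 𝒮.brx (𝒮.x j) J p * 𝒮.ηMulti I J p) := by ring
    _ = _ := by rw [hs, div_mul_div_comm, mul_one]

omit [T2Space S] in
theorem D_eq_sum (h𝒮 : 𝒮.Compatible) (hp : p ∈ 𝒮.domain) (i j : Fin m) :
    𝒮.D i j p = ∑ a, ∑ b, (metricMatrix 𝒮.g 𝒮.ψ (𝒮.ψ p))⁻¹ a b *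
      tang 𝒮.coordMap a (𝒮.ψ p) i * tang 𝒮.coordMap b (𝒮.ψ p) j := by
  rw [D, h𝒮 p hp.1 hp.2]
  have hγ := (𝒮.γ_pos p).ne'
  have hε : 𝒮.ε * 𝒮.ε = 1 := by rcases 𝒮.ε_sign with h | h <;> rw [h] <;> norm_num
  have : 𝒮.ε / 𝒮.γ p ^ 2 * (𝒮.ε * 𝒮.γ p ^ 2) = 1 := by
    field_simp
    linarith
  rw [← mul_assoc, this, one_mul]
  rfl

/-- The compatibility relation speaks of D^i(x^j) only. A derivation is determined by these values
since the differentials of the x^j span the cotangent space of an immersed submanifold. -/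
theorem Dder_eq (h𝒮 : 𝒮.Compatible) (hp : p ∈ 𝒮.domain) {f : S → ℝ}
    (hf : ContDiffOn ℝ ∞ (fun u ↦ f (𝒮.ψ.symm u)) 𝒮.coordDomain) (i : Fin m) :
    𝒮.Dder i f p = ∑ a, ∑ b, (metricMatrix 𝒮.g 𝒮.ψ (𝒮.ψ p))⁻¹ a b *
      tang 𝒮.coordMap a (𝒮.ψ p) i * pderiv b (fun u ↦ f (𝒮.ψ.symm u)) (𝒮.ψ p) := by
  have h := 𝒮.isImmersionOn
  have hu := mem_coordDomain hp
  set W : Fin n → ℝ := fun a ↦ 𝒮.Dder i (fun q ↦ 𝒮.ψ q a) p with hW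
  -- Two expressions of D^{ij}: as the derivation D^i applied to x^j, and by compatibility.
  -- Independence of the ∂_a F then identifies the coefficients.
  have h1 : ∀ j, ∑ a, tang 𝒮.coordMap a (𝒮.ψ p) j * W a = ∑ a,
      tang 𝒮.coordMap a (𝒮.ψ p) j * ∑ b, (metricMatrix 𝒮.g 𝒮.ψ (𝒮.ψ p))⁻¹ b a *
        tang 𝒮.coordMap b (𝒮.ψ p) i := by
    intro j
    have e1 := Dder_eq_sum (f := 𝒮.x j) hp (h.smooth_coord j) i
    change 𝒮.Dder i (𝒮.x j) p = ∑ a, tang 𝒮.coordMap a (𝒮.ψ p) j * W a at e1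
    rw [← e1, ← D_eq_Dder, D_eq_sum h𝒮 hp, Finset.sum_comm]
    refine Finset.sum_congr rfl fun b _ ↦ ?_
    rw [Finset.mul_sum]
    exact Finset.sum_congr rfl fun a _ ↦ by ring
  have h2 := h.eq_of_sum_tang_eq hu h1
  rw [Dder_eq_sum hp hf, Finset.sum_comm]
  refine Finset.sum_congr rfl fun b _ ↦ ?_
  change _ * W b = _
  rw [h2 b, Finset.mul_sum]
  exact Finset.sum_congr rfl fun a _ ↦ by ring

end Derivation

end Setting

/-! ### The normal projection of an immersion -/

section NormalProjection

variable {m n : ℕ}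

/-- The components of the projection to the normal space of an immersion. -/
def normalProj (G : Coord m → Matrix (Fin m) (Fin m) ℝ) (F : Coord n → Coord m)
    (g : Coord n → Matrix (Fin n) (Fin n) ℝ) (u : Coord n) (i j : Fin m) : ℝ :=
  (if i = j then 1 else 0)
    - ∑ k, (∑ a, ∑ b, (g u)⁻¹ a b * tang F a u i * tang F b u k) * G (F u) k j

/-- The components of the normal projection with both indices lowered. -/
def normalProjLow (G : Coord m → Matrix (Fin m) (Fin m) ℝ) (F : Coord n → Coord m)
    (g : Coord n → Matrix (Fin n) (Fin n) ℝ) (u : Coord n) (i j : Fin m) : ℝ :=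
  ∑ k, G (F u) i k * normalProj G F g u k j

theorem bil_sum_left {A : Matrix (Fin m) (Fin m) ℝ} {κ : Type*} (s : Finset κ)
    (c : κ → ℝ) (v : κ → Fin m → ℝ) (w : Fin m → ℝ) :
    bil A (fun i ↦ ∑ a ∈ s, c a * v a i) w = ∑ a ∈ s, c a * bil A (v a) w := by
  simp only [bil, Finset.mul_sum, Finset.sum_mul]
  conv_rhs => rw [Finset.sum_comm]
  refine Finset.sum_congr rfl fun i _ ↦ ?_
  conv_rhs => rw [Finset.sum_comm]
  exact Finset.sum_congr rfl fun _ _ ↦ Finset.sum_congr rfl fun _ _ ↦ by ring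

namespace IsImmersionOn

variable {G : Coord m → Matrix (Fin m) (Fin m) ℝ} {W : Set (Coord m)}
  {F : Coord n → Coord m} {g : Coord n → Matrix (Fin n) (Fin n) ℝ} {U : Set (Coord n)}
  {u : Coord n}

theorem smooth_normalProj (h : IsImmersionOn G W F g U) (i j : Fin m) :
    ContDiffOn ℝ ∞ (fun z ↦ normalProj G F g z i j) U :=
  contDiffOn_const.sub <| ContDiffOn.sum fun k _ ↦
    (ContDiffOn.sum fun a _ ↦ ContDiffOn.sum fun b _ ↦
      ((contDiffOn_inv_entry h.source.smooth h.source.isUnit a b).mul (h.smooth_tang a i)).mul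
        (h.smooth_tang b k)).mul (h.smooth_comp (h.target.smooth k j))

theorem smooth_normalProjLow (h : IsImmersionOn G W F g U) (i j : Fin m) :
    ContDiffOn ℝ ∞ (fun z ↦ normalProjLow G F g z i j) U :=
  ContDiffOn.sum fun k _ ↦ (h.smooth_comp (h.target.smooth i k)).mul (h.smooth_normalProj k j)

theorem _root_.MultiBracket.sum_normalProj_mul (u : Coord n) (v : Fin m → ℝ) (i : Fin m) :
    ∑ j, normalProj G F g u i j * v j =
      v i - ∑ a, (∑ b, (g u)⁻¹ a b * bil (G (F u)) (tang F b u) v) * tang F a u i := by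
  simp only [normalProj, sub_mul, Finset.sum_sub_distrib, ite_mul, one_mul, zero_mul,
    Finset.sum_ite_eq, Finset.mem_univ, if_true]
  congr 1
  simp only [bil, Finset.mul_sum, Finset.sum_mul]
  rw [Finset.sum_comm]
  calc _ = ∑ k, ∑ a, ∑ b, ∑ j, (g u)⁻¹ a b * tang F a u i * tang F b u k * G (F u) k j * v j := by
        refine Finset.sum_congr rfl fun k _ ↦ ?_
        rw [Finset.sum_comm]
        exact Finset.sum_congr rfl fun _ _ ↦ Finset.sum_comm
    _ = ∑ a, ∑ b, ∑ k, ∑ j, (g u)⁻¹ a b * tang F a u i * tang F b u k * G (F u) k j * v j := by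
        rw [Finset.sum_comm]
        exact Finset.sum_congr rfl fun _ _ ↦ Finset.sum_comm
    _ = _ := Finset.sum_congr rfl fun _ _ ↦ Finset.sum_congr rfl fun _ _ ↦
        Finset.sum_congr rfl fun _ _ ↦ Finset.sum_congr rfl fun _ _ ↦ by ring

theorem sum_normalProj_mul_tang (h : IsImmersionOn G W F g U) (hu : u ∈ U) (i : Fin m)
    (b : Fin n) : ∑ j, normalProj G F g u i j * tang F b u j = 0 := by
  rw [sum_normalProj_mul]
  simp [← h.pullback u hu, h.inv_mul_metric hu]

theorem sum_normalProjLow_mul_tang (h : IsImmersionOn G W F g U) (hu : u ∈ U) (i : Fin m)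
    (b : Fin n) : ∑ j, normalProjLow G F g u i j * tang F b u j = 0 := by
  simp only [normalProjLow, Finset.sum_mul]
  rw [Finset.sum_comm]
  refine Finset.sum_eq_zero fun k _ ↦ ?_
  simp only [mul_assoc]
  rw [← Finset.mul_sum, h.sum_normalProj_mul_tang hu, mul_zero]

theorem normalBil_symm (h : IsImmersionOn G W F g U) (hu : u ∈ U) (v w : Fin m → ℝ) :
    normalBil G F g u v w = normalBil G F g u w v := by
  rw [normalBil, normalBil, bil_symm (h.target.symm _ (h.mapsTo u hu)) v w, Finset.sum_comm]
  congr 1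
  refine Finset.sum_congr rfl fun a _ ↦ Finset.sum_congr rfl fun b _ ↦ ?_
  rw [h.source.inv_symm hu b a]
  ring

/-- The left side is ⟨Πw, Πv⟩. As Πv is orthogonal to the tangent vectors (`e3`), it equals ⟨w, Πv⟩,
and expanding Πv gives `normalBil`. -/
theorem sum_normalProjLow_mul (h : IsImmersionOn G W F g U) (hu : u ∈ U) (v w : Fin m → ℝ) :
    ∑ r, (∑ i, normalProjLow G F g u r i * v i) * ∑ j, normalProj G F g u r j * w j =
      normalBil G F g u v w := by
  have hs := h.target.symm _ (h.mapsTo u hu)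
  have e1 : ∑ r, (∑ i, normalProjLow G F g u r i * v i) * ∑ j, normalProj G F g u r j * w j =
      bil (G (F u)) (fun r ↦ ∑ j, normalProj G F g u r j * w j)
        (fun r ↦ ∑ j, normalProj G F g u r j * v j) := by
    unfold bil normalProjLow
    refine Finset.sum_congr rfl fun r _ ↦ ?_
    have : ∑ i, (∑ k, G (F u) r k * normalProj G F g u k i) * v i =
        ∑ k, G (F u) r k * ∑ j, normalProj G F g u k j * v j := by
      simp only [Finset.mul_sum, Finset.sum_mul]
      rw [Finset.sum_comm]
      exact Finset.sum_congr rfl fun _ _ ↦ Finset.sum_congr rfl fun _ _ ↦ by ring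
    rw [this, Finset.sum_mul]
    exact Finset.sum_congr rfl fun _ _ ↦ by ring
  have e2 : ∀ w v : Fin m → ℝ, bil (G (F u)) (fun r ↦ ∑ j, normalProj G F g u r j * w j) v =
      bil (G (F u)) w v - ∑ a, (∑ b, (g u)⁻¹ a b * bil (G (F u)) (tang F b u) w)
        * bil (G (F u)) (tang F a u) v := by
    intro w v
    simp only [sum_normalProj_mul]
    rw [← bil_sum_left, ← bil_sub_left]
    rfl
  have e3 : ∀ b, bil (G (F u)) (tang F b u) (fun r ↦ ∑ j, normalProj G F g u r j * v j) = 0 := by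
    intro b
    have hg : ∀ c, ∑ a, (g u)⁻¹ a c * bil (G (F u)) (tang F a u) (tang F b u) =
        if c = b then 1 else 0 := fun c ↦ by
      simp only [← h.pullback u hu, h.source.inv_symm hu _ c, h.inv_mul_metric hu]
    rw [bil_symm hs, e2, sub_eq_zero, bil_symm hs v]
    simp only [Finset.sum_mul]
    rw [Finset.sum_comm]
    calc _ = ∑ c, (if c = b then 1 else 0) * bil (G (F u)) (tang F c u) v := by simp
      _ = _ := by
        simp only [← hg, Finset.sum_mul]
        exact Finset.sum_congr rfl fun _ _ ↦ Finset.sum_congr rfl fun _ _ ↦ by ring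
  rw [e1, e2]
  simp only [e3, mul_zero, Finset.sum_const_zero, sub_zero]
  rw [bil_symm hs, e2, normalBil]
  congr 1
  rw [Finset.sum_comm]
  refine Finset.sum_congr rfl fun a _ ↦ ?_
  rw [Finset.sum_mul]
  refine Finset.sum_congr rfl fun b _ ↦ ?_
  rw [h.source.inv_symm hu b a, bil_symm hs v, bil_symm hs w]

/-- The covariant derivative of a one-form that annihilates the tangent spaces. -/
theorem sum_covd_mul_tang (h : IsImmersionOn G W F g U) (hu : u ∈ U) {θ : Coord n → Fin m → ℝ}
    (hθ : ∀ j, ContDiffOn ℝ ∞ (fun z ↦ θ z j) U) (b c : Fin n)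
    (h0 : ∀ z ∈ U, ∑ j, θ z j * tang F b z j = 0) :
    ∑ j, (pderiv c (fun z ↦ θ z j) u
      - ∑ l, ∑ q, tang F c u l * christoffel G q l j (F u) * θ u q) * tang F b u j =
      -∑ j, θ u j * covd G F c (tang F b) u j := by
  -- The derivative of the vanishing pairing of θ with ∂_b F. The Christoffel terms of the one-form
  -- and of the vector field cancel by `e2`.
  have e1 : ∑ j, (pderiv c (fun z ↦ θ z j) u * tang F b u j
      + θ u j * pderiv c (fun z ↦ tang F b z j) u) = 0 := by
    have := pderiv_congr_on h.source.isOpen hu h0 c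
    rw [pderiv_const, pderiv_sum _ fun j _ ↦ h.diffAt hu ((hθ j).mul (h.smooth_tang b j))] at this
    rw [← this]
    exact Finset.sum_congr rfl fun j _ ↦
      (pderiv_mul (h.diffAt hu (hθ j)) (h.diffAt hu (h.smooth_tang b j)) c).symm
  have e2 : ∑ j, (∑ l, ∑ q, tang F c u l * christoffel G q l j (F u) * θ u q) * tang F b u j =
      ∑ j, θ u j * ∑ l, ∑ q, christoffel G j l q (F u) * tang F c u l * tang F b u q := by
    simp only [Finset.mul_sum, Finset.sum_mul]
    rw [sum_reverse]
    exact Finset.sum_congr rfl fun _ _ ↦ Finset.sum_congr rfl fun _ _ ↦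
      Finset.sum_congr rfl fun _ _ ↦ by ring
  simp only [covd, sub_mul, mul_add, Finset.sum_sub_distrib, Finset.sum_add_distrib, e2] at e1 ⊢
  linarith

end IsImmersionOn

end NormalProjection

/-! ### The derivatives of Π along tangent directions -/

namespace Setting

variable {m n N : ℕ} {M S : Type*}
  [TopologicalSpace M] [ChartedSpace (EuclideanSpace ℝ (Fin m)) M] [IsManifold (𝓡 m) ∞ M]
  [TopologicalSpace S] [ChartedSpace (EuclideanSpace ℝ (Fin n)) S] [IsManifold (𝓡 n) ∞ S]
  {𝒮 : Setting m n N M S} {p : S}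

theorem coordMap_apply (hp : p ∈ 𝒮.domain) : 𝒮.coordMap (𝒮.ψ p) = 𝒮.φ (𝒮.ι p) := by
  rw [coordMap, 𝒮.ψ.left_inv hp.1]

theorem ηc_eq (hp : p ∈ 𝒮.domain) (i j : Fin m) :
    𝒮.ηc i j p = metricMatrix 𝒮.η 𝒮.φ (𝒮.coordMap (𝒮.ψ p)) i j := by
  rw [ηc, coordMap_apply hp]

theorem Γ_eq (hp : p ∈ 𝒮.domain) (i j k : Fin m) :
    𝒮.Γ i j k p = christoffel (metricMatrix 𝒮.η 𝒮.φ) i j k (𝒮.coordMap (𝒮.ψ p)) := by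
  rw [Γ, coordMap_apply hp]

theorem Rbar_eq (hp : p ∈ 𝒮.domain) (i j k l : Fin m) :
    𝒮.Rbar i j k l p = riemann (metricMatrix 𝒮.η 𝒮.φ) i j k l (𝒮.coordMap (𝒮.ψ p)) := by
  rw [Rbar, coordMap_apply hp]

theorem Proj_eq (h𝒮 : 𝒮.Compatible) (hp : p ∈ 𝒮.domain) (i j : Fin m) :
    𝒮.Proj i j p = normalProj (metricMatrix 𝒮.η 𝒮.φ) 𝒮.coordMap (metricMatrix 𝒮.g 𝒮.ψ)
      (𝒮.ψ p) i j := by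
  simp only [Proj, normalProj, D_eq_sum h𝒮 hp, ηc_eq hp]

theorem ProjLow_eq (h𝒮 : 𝒮.Compatible) (hp : p ∈ 𝒮.domain) (i j : Fin m) :
    𝒮.ProjLow i j p = normalProjLow (metricMatrix 𝒮.η 𝒮.φ) 𝒮.coordMap (metricMatrix 𝒮.g 𝒮.ψ)
      (𝒮.ψ p) i j := by
  simp only [ProjLow, normalProjLow, Proj_eq h𝒮 hp, ηc_eq hp]

theorem Proj_symm_eq (h𝒮 : 𝒮.Compatible) (i j : Fin m) {u : Coord n} (hu : u ∈ 𝒮.coordDomain) :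
    𝒮.Proj i j (𝒮.ψ.symm u) = normalProj (metricMatrix 𝒮.η 𝒮.φ) 𝒮.coordMap
      (metricMatrix 𝒮.g 𝒮.ψ) u i j := by
  rw [Proj_eq h𝒮 (symm_mem_domain hu), 𝒮.ψ.right_inv hu.1]

theorem ProjLow_symm_eq (h𝒮 : 𝒮.Compatible) (i j : Fin m) {u : Coord n}
    (hu : u ∈ 𝒮.coordDomain) :
    𝒮.ProjLow i j (𝒮.ψ.symm u) = normalProjLow (metricMatrix 𝒮.η 𝒮.φ) 𝒮.coordMap
      (metricMatrix 𝒮.g 𝒮.ψ) u i j := by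
  rw [ProjLow_eq h𝒮 (symm_mem_domain hu), 𝒮.ψ.right_inv hu.1]

/-- The vector g^{ab} t_b ∂_a F is the tangent vector whose inner product with each ∂_c F is t_c.
With t the partial derivatives of a function, contraction with ∂_c F turns D_k into ∂_c. -/
theorem sum_tang_mul_lower (hp : p ∈ 𝒮.domain) (c : Fin n) (t : Fin n → ℝ) :
    ∑ k, tang 𝒮.coordMap c (𝒮.ψ p) k * ∑ i, 𝒮.ηc k i p * ∑ a, ∑ b,
      (metricMatrix 𝒮.g 𝒮.ψ (𝒮.ψ p))⁻¹ a b * tang 𝒮.coordMap a (𝒮.ψ p) i * t b = t c := by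
  have h := 𝒮.isImmersionOn
  have hu := mem_coordDomain hp
  set g := metricMatrix 𝒮.g 𝒮.ψ (𝒮.ψ p)
  have e1 := h.bil_tang_sum hu c fun a ↦ ∑ b, g⁻¹ a b * t b
  have e2 : ∑ a, g c a * ∑ b, g⁻¹ a b * t b = t c := by
    calc _ = ∑ b, (∑ a, g c a * g⁻¹ a b) * t b := by
          simp only [Finset.mul_sum, Finset.sum_mul]
          rw [Finset.sum_comm]
          exact Finset.sum_congr rfl fun _ _ ↦ Finset.sum_congr rfl fun _ _ ↦ by ring
      _ = t c := by simp [g, h.source.sum_mul_inv hu]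
  rw [e2] at e1
  rw [← e1, bil]
  refine Finset.sum_congr rfl fun k _ ↦ ?_
  rw [Finset.mul_sum]
  refine Finset.sum_congr rfl fun i _ ↦ ?_
  rw [ηc_eq hp]
  have : ∑ a, ∑ b, g⁻¹ a b * tang 𝒮.coordMap a (𝒮.ψ p) i * t b =
      ∑ a, tang 𝒮.coordMap a (𝒮.ψ p) i * ∑ b, g⁻¹ a b * t b := by
    simp only [Finset.mul_sum]
    exact Finset.sum_congr rfl fun _ _ ↦ Finset.sum_congr rfl fun _ _ ↦ by ring
  rw [this]
  ring

theorem sum_tang_mul_DderLow [T2Space S] (h𝒮 : 𝒮.Compatible) (hp : p ∈ 𝒮.domain) {f : S → ℝ}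
    (hf : ContDiffOn ℝ ∞ (fun u ↦ f (𝒮.ψ.symm u)) 𝒮.coordDomain) (c : Fin n) :
    ∑ k, tang 𝒮.coordMap c (𝒮.ψ p) k * 𝒮.DderLow k f p =
      pderiv c (fun u ↦ f (𝒮.ψ.symm u)) (𝒮.ψ p) := by
  simp only [DderLow, Dder_eq h𝒮 hp hf]
  exact sum_tang_mul_lower hp c fun b ↦ pderiv b (fun u ↦ f (𝒮.ψ.symm u)) (𝒮.ψ p)

theorem sum_tang_mul_Dlow (h𝒮 : 𝒮.Compatible) (hp : p ∈ 𝒮.domain) (c : Fin n) (l : Fin m) :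
    ∑ k, tang 𝒮.coordMap c (𝒮.ψ p) k * 𝒮.Dlow k l p = tang 𝒮.coordMap c (𝒮.ψ p) l := by
  simp only [Dlow, D_eq_sum h𝒮 hp]
  exact sum_tang_mul_lower hp c fun b ↦ tang 𝒮.coordMap b (𝒮.ψ p) l

theorem sum_tang_mul_sum_Dlow (h𝒮 : 𝒮.Compatible) (hp : p ∈ 𝒮.domain) (c : Fin n)
    (A : Fin m → Fin m → ℝ) :
    ∑ k, tang 𝒮.coordMap c (𝒮.ψ p) k * ∑ l, ∑ q, 𝒮.Dlow k l p * A l q =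
      ∑ l, ∑ q, tang 𝒮.coordMap c (𝒮.ψ p) l * A l q := by
  conv_rhs => enter [2, l, 2, q]; rw [← sum_tang_mul_Dlow h𝒮 hp c]
  simp only [Finset.mul_sum, Finset.sum_mul]
  rw [Finset.sum_comm]
  refine Finset.sum_congr rfl fun l _ ↦ ?_
  rw [Finset.sum_comm]
  exact Finset.sum_congr rfl fun _ _ ↦ Finset.sum_congr rfl fun _ _ ↦ by ring

/-- Treats Π^i_j and Π_{ij} together: `E` stands for the Christoffel symbols acting on the first
index, whatever its position. Their term still contains the tensor contracted with ∂_b F, so it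
vanishes (`e2`), and each row behaves like a one-form annihilating the tangent space. -/
theorem sum_covd_tensor [T2Space S] (h𝒮 : 𝒮.Compatible) (hp : p ∈ 𝒮.domain) (c b : Fin n)
    {T : Fin m → Fin m → S → ℝ} {t : Coord n → Fin m → Fin m → ℝ} (r : Fin m)
    (E : Fin m → Fin m → ℝ)
    (ht : ∀ u ∈ 𝒮.coordDomain, ∀ i j, T i j (𝒮.ψ.symm u) = t u i j)
    (hs : ∀ i j, ContDiffOn ℝ ∞ (fun u ↦ t u i j) 𝒮.coordDomain)
    (h0 : ∀ u ∈ 𝒮.coordDomain, ∀ i, ∑ j, t u i j * tang 𝒮.coordMap b u j = 0) :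
    ∑ k, (∑ j, (𝒮.DderLow k (T r j) p + ∑ l, ∑ q, 𝒮.Dlow k l p * (E l q * T q j p)
      - ∑ l, ∑ q, 𝒮.Dlow k l p * (𝒮.Γ q l j p * T r q p)) * tang 𝒮.coordMap b (𝒮.ψ p) j)
        * tang 𝒮.coordMap c (𝒮.ψ p) k =
      -∑ j, t (𝒮.ψ p) r j *
        covd (metricMatrix 𝒮.η 𝒮.φ) 𝒮.coordMap c (tang 𝒮.coordMap b) (𝒮.ψ p) j := by
  have h := 𝒮.isImmersionOn
  have hu := mem_coordDomain hp
  have htp : ∀ i j, T i j p = t (𝒮.ψ p) i j := fun i j ↦ by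
    rw [← ht _ hu, 𝒮.ψ.left_inv hp.1]
  have e1 : ∀ j, ∑ k, tang 𝒮.coordMap c (𝒮.ψ p) k * 𝒮.DderLow k (T r j) p =
      pderiv c (fun u ↦ t u r j) (𝒮.ψ p) := fun j ↦ by
    rw [sum_tang_mul_DderLow h𝒮 hp ((hs r j).congr fun u hu ↦ ht u hu r j)]
    exact pderiv_congr_on 𝒮.isOpen_coordDomain hu (fun u hu ↦ ht u hu r j) c
  have e2 : ∑ j, (∑ l, ∑ q, tang 𝒮.coordMap c (𝒮.ψ p) l * (E l q * t (𝒮.ψ p) q j))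
      * tang 𝒮.coordMap b (𝒮.ψ p) j = 0 := by
    simp only [Finset.sum_mul]
    rw [Finset.sum_comm]
    refine Finset.sum_eq_zero fun l _ ↦ ?_
    rw [Finset.sum_comm]
    refine Finset.sum_eq_zero fun q _ ↦ ?_
    calc _ = tang 𝒮.coordMap c (𝒮.ψ p) l * E l q *
          ∑ j, t (𝒮.ψ p) q j * tang 𝒮.coordMap b (𝒮.ψ p) j := by
          rw [Finset.mul_sum]
          exact Finset.sum_congr rfl fun _ _ ↦ by ring
      _ = 0 := by rw [h0 _ hu, mul_zero]
  rw [← h.sum_covd_mul_tang hu (hs r) b c fun u hu ↦ h0 u hu r]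
  calc _ = ∑ j, (∑ k, tang 𝒮.coordMap c (𝒮.ψ p) k * 𝒮.DderLow k (T r j) p
        + ∑ k, tang 𝒮.coordMap c (𝒮.ψ p) k * ∑ l, ∑ q, 𝒮.Dlow k l p * (E l q * T q j p)
        - ∑ k, tang 𝒮.coordMap c (𝒮.ψ p) k *
          ∑ l, ∑ q, 𝒮.Dlow k l p * (𝒮.Γ q l j p * T r q p)) * tang 𝒮.coordMap b (𝒮.ψ p) j := by
        conv_lhs => enter [2, k]; rw [Finset.sum_mul]
        rw [Finset.sum_comm]
        refine Finset.sum_congr rfl fun j _ ↦ ?_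
        rw [← Finset.sum_add_distrib, ← Finset.sum_sub_distrib, Finset.sum_mul]
        exact Finset.sum_congr rfl fun k _ ↦ by ring
    _ = _ := by
        simp only [e1, sum_tang_mul_sum_Dlow h𝒮 hp c, htp, Γ_eq hp, add_mul, sub_mul,
          Finset.sum_add_distrib, Finset.sum_sub_distrib, e2, add_zero]
        simp only [mul_assoc]

theorem sum_nablaHat_Proj [T2Space S] (h𝒮 : 𝒮.Compatible) (hp : p ∈ 𝒮.domain) (c b : Fin n)
    (r : Fin m) :
    ∑ k, (∑ j, 𝒮.nablaHat 𝒮.Proj k r j p * tang 𝒮.coordMap b (𝒮.ψ p) j)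
        * tang 𝒮.coordMap c (𝒮.ψ p) k =
      -∑ j, normalProj (metricMatrix 𝒮.η 𝒮.φ) 𝒮.coordMap (metricMatrix 𝒮.g 𝒮.ψ) (𝒮.ψ p) r j *
        covd (metricMatrix 𝒮.η 𝒮.φ) 𝒮.coordMap c (tang 𝒮.coordMap b) (𝒮.ψ p) j := by
  rw [← sum_covd_tensor h𝒮 hp c b r (fun l q ↦ 𝒮.Γ r l q p)
    (fun u hu i j ↦ Proj_symm_eq h𝒮 i j hu) (𝒮.isImmersionOn.smooth_normalProj)
    (fun u hu i ↦ 𝒮.isImmersionOn.sum_normalProj_mul_tang hu i b)]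
  simp only [nablaHat, mul_assoc]

theorem sum_nablaHatLow_ProjLow [T2Space S] (h𝒮 : 𝒮.Compatible) (hp : p ∈ 𝒮.domain)
    (c b : Fin n) (r : Fin m) :
    ∑ k, (∑ j, 𝒮.nablaHatLow 𝒮.ProjLow k r j p * tang 𝒮.coordMap b (𝒮.ψ p) j)
        * tang 𝒮.coordMap c (𝒮.ψ p) k =
      -∑ j, normalProjLow (metricMatrix 𝒮.η 𝒮.φ) 𝒮.coordMap (metricMatrix 𝒮.g 𝒮.ψ) (𝒮.ψ p) r j *
        covd (metricMatrix 𝒮.η 𝒮.φ) 𝒮.coordMap c (tang 𝒮.coordMap b) (𝒮.ψ p) j := by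
  -- The minus sign in `E` reflects that the first index is now lowered.
  rw [← sum_covd_tensor h𝒮 hp c b r (fun l q ↦ -𝒮.Γ q l r p)
    (fun u hu i j ↦ ProjLow_symm_eq h𝒮 i j hu) (𝒮.isImmersionOn.smooth_normalProjLow)
    (fun u hu i ↦ 𝒮.isImmersionOn.sum_normalProjLow_mul_tang hu i b)]
  simp only [nablaHatLow, mul_assoc, neg_mul, mul_neg, Finset.sum_neg_distrib, ← sub_eq_add_neg]

end Setting

/-! ### Contraction of tensors with four indices -/

section Contraction

variable {m n : ℕ}

/-- The contraction of a tensor with four indices with the columns of a matrix. -/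
def contract (K : Fin m → Fin m → Fin m → Fin m → ℝ) (T : Fin n → Fin m → ℝ)
    (a b c d : Fin n) : ℝ :=
  ∑ l, (∑ k, (∑ j, (∑ i, K i j k l * T a i) * T b j) * T c k) * T d l

/-- Contracts the first slot and moves the new index to the last place; four applications treat all
slots and restore their order. -/
theorem sum_rotate {κ₁ κ₂ κ₃ : Type*} [Fintype κ₁] [Fintype κ₂] [Fintype κ₃]
    (K : Fin m → κ₁ → κ₂ → κ₃ → ℝ) (T : Fin n → Fin m → ℝ) (x : Fin n → ℝ)
    (y : κ₁ → ℝ) (z : κ₂ → ℝ) (w : κ₃ → ℝ) :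
    ∑ i, ∑ j, ∑ k, ∑ l, K i j k l * (∑ a, T a i * x a) * y j * z k * w l =
      ∑ j, ∑ k, ∑ l, ∑ a, (∑ i, K i j k l * T a i) * y j * z k * w l * x a := by
  rw [Finset.sum_comm]
  refine Finset.sum_congr rfl fun j _ ↦ ?_
  rw [Finset.sum_comm]
  refine Finset.sum_congr rfl fun k _ ↦ ?_
  rw [Finset.sum_comm]
  refine Finset.sum_congr rfl fun l _ ↦ ?_
  simp only [Finset.mul_sum, Finset.sum_mul]
  rw [Finset.sum_comm]
  exact Finset.sum_congr rfl fun _ _ ↦ Finset.sum_congr rfl fun _ _ ↦ by ring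

theorem sum_mul_eq_sum_contract (K : Fin m → Fin m → Fin m → Fin m → ℝ) (T : Fin n → Fin m → ℝ)
    (x y z w : Fin n → ℝ) :
    ∑ i, ∑ j, ∑ k, ∑ l, K i j k l * (∑ a, T a i * x a) * (∑ a, T a j * y a) *
        (∑ a, T a k * z a) * (∑ a, T a l * w a) =
      ∑ a, ∑ b, ∑ c, ∑ d, contract K T a b c d * x a * y b * z c * w d := by
  rw [sum_rotate K T x, sum_rotate (fun j k l a ↦ ∑ i, K i j k l * T a i) T y,
    sum_rotate (fun k l a b ↦ ∑ j, (∑ i, K i j k l * T a i) * T b j) T z,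
    sum_rotate (fun l a b c ↦ ∑ k, (∑ j, (∑ i, K i j k l * T a i) * T b j) * T c k) T w]
  rfl

/-- The slots split into the pairs (i, k) and (j, l), each belonging to one factor, so for fixed `r`
the contraction is a product. -/
theorem contract_sum_mul (A B : Fin m → Fin m → Fin m → ℝ) (T : Fin n → Fin m → ℝ)
    (a b c d : Fin n) :
    contract (fun i j k l ↦ ∑ r, A k r i * B l r j) T a b c d =
      ∑ r, (∑ k, (∑ i, A k r i * T a i) * T c k) * ∑ l, (∑ j, B l r j * T b j) * T d l := by
  have e1 : ∀ j k l, ∑ i, (∑ r, A k r i * B l r j) * T a i =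
      ∑ r, (∑ i, A k r i * T a i) * B l r j := by
    intro j k l
    simp only [Finset.sum_mul]
    rw [Finset.sum_comm]
    exact Finset.sum_congr rfl fun _ _ ↦ Finset.sum_congr rfl fun _ _ ↦ by ring
  have e2 : ∀ k l, ∑ j, (∑ r, (∑ i, A k r i * T a i) * B l r j) * T b j =
      ∑ r, (∑ i, A k r i * T a i) * ∑ j, B l r j * T b j := by
    intro k l
    conv_lhs => enter [2, j]; rw [Finset.sum_mul]
    conv_rhs => enter [2, r]; rw [Finset.mul_sum]
    rw [Finset.sum_comm]
    exact Finset.sum_congr rfl fun _ _ ↦ Finset.sum_congr rfl fun _ _ ↦ by ring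
  have e3 : ∀ l, ∑ k, (∑ r, (∑ i, A k r i * T a i) * ∑ j, B l r j * T b j) * T c k =
      ∑ r, (∑ k, (∑ i, A k r i * T a i) * T c k) * ∑ j, B l r j * T b j := by
    intro l
    conv_lhs => enter [2, k]; rw [Finset.sum_mul]
    conv_rhs => enter [2, r]; rw [Finset.sum_mul]
    rw [Finset.sum_comm]
    exact Finset.sum_congr rfl fun _ _ ↦ Finset.sum_congr rfl fun _ _ ↦ by ring
  simp only [contract, e1, e2, e3]
  conv_lhs => enter [2, l]; rw [Finset.sum_mul]
  conv_rhs => enter [2, r]; rw [Finset.mul_sum]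
  rw [Finset.sum_comm]
  exact Finset.sum_congr rfl fun _ _ ↦ Finset.sum_congr rfl fun _ _ ↦ by ring

theorem contract_swap (K : Fin m → Fin m → Fin m → Fin m → ℝ) (T : Fin n → Fin m → ℝ)
    (a b c d : Fin n) : contract (fun i j k l ↦ K j i k l) T a b c d = contract K T b a c d := by
  unfold contract
  refine Finset.sum_congr rfl fun l _ ↦ ?_
  congr 1
  refine Finset.sum_congr rfl fun k _ ↦ ?_
  congr 1
  simp only [Finset.sum_mul]
  rw [Finset.sum_comm]
  exact Finset.sum_congr rfl fun _ _ ↦ Finset.sum_congr rfl fun _ _ ↦ by ring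

theorem contract_add_sub (K A B : Fin m → Fin m → Fin m → Fin m → ℝ) (T : Fin n → Fin m → ℝ)
    (a b c d : Fin n) :
    contract (fun i j k l ↦ K i j k l + A i j k l - B i j k l) T a b c d =
      contract K T a b c d + contract A T a b c d - contract B T a b c d := by
  simp only [contract, add_mul, sub_mul, Finset.sum_add_distrib, Finset.sum_sub_distrib]

theorem contract_eq_sum (K : Fin m → Fin m → Fin m → Fin m → ℝ) (T : Fin n → Fin m → ℝ)
    (a b c d : Fin n) : contract K T a b c d =
      ∑ i, ∑ j, ∑ k, ∑ l, K i j k l * T a i * T b j * T c k * T d l := by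
  simp only [contract, Finset.sum_mul]
  conv_lhs => enter [2, l]; rw [sum_reverse]
  rw [Finset.sum_comm]
  refine Finset.sum_congr rfl fun i _ ↦ ?_
  rw [Finset.sum_comm]
  exact Finset.sum_congr rfl fun j _ ↦ Finset.sum_comm

end Contraction

end MultiBracket

end

/-! ### The main theorem -/

theorem mainTheorem4 {m n N : ℕ} {M S : Type*}
    [TopologicalSpace M] [ChartedSpace (EuclideanSpace ℝ (Fin m)) M] [IsManifold (𝓡 m) ∞ M]
    [TopologicalSpace S] [T2Space S] [ChartedSpace (EuclideanSpace ℝ (Fin n)) S]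
    [IsManifold (𝓡 n) ∞ S]
    (𝒮 : MultiBracket.Setting m n N M S) (h𝒮 : 𝒮.Compatible)
    (p : S) (hψ : p ∈ 𝒮.ψ.source) (hφ : 𝒮.ι p ∈ 𝒮.φ.source)
    (X Y Z V : TangentSpace (𝓡 n) p) :
    MultiBracket.curvature 𝒮.g 𝒮.ψ p X Y Z V =
      ∑ i, ∑ j, ∑ k, ∑ l,
        (𝒮.Rbar i j k l p
          + ∑ r, 𝒮.nablaHatLow 𝒮.ProjLow k r i p * 𝒮.nablaHat 𝒮.Proj l r j p
          - ∑ r, 𝒮.nablaHatLow 𝒮.ProjLow k r j p * 𝒮.nablaHat 𝒮.Proj l r i p) *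
        𝒮.vec p X i * 𝒮.vec p Y j * 𝒮.vec p Z k * 𝒮.vec p V l := by
  have hp : p ∈ 𝒮.domain := ⟨hψ, hφ⟩
  have h := 𝒮.isImmersionOn
  have hu := MultiBracket.Setting.mem_coordDomain hp
  simp only [MultiBracket.Setting.vec_eq_sum hp]
  -- With all vectors expanded in the ∂_a F, it suffices to compare the coefficients of X^a Y^b Z^c
  -- V^d.
  rw [MultiBracket.sum_mul_eq_sum_contract (fun i j k l ↦ 𝒮.Rbar i j k l p
          + ∑ r, 𝒮.nablaHatLow 𝒮.ProjLow k r i p * 𝒮.nablaHat 𝒮.Proj l r j p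
          - ∑ r, 𝒮.nablaHatLow 𝒮.ProjLow k r j p * 𝒮.nablaHat 𝒮.Proj l r i p)
    (fun a ↦ MultiBracket.tang 𝒮.coordMap a (𝒮.ψ p)), MultiBracket.curvature]
  refine Finset.sum_congr rfl fun a _ ↦ Finset.sum_congr rfl fun b _ ↦
    Finset.sum_congr rfl fun c _ ↦ Finset.sum_congr rfl fun d _ ↦ ?_
  congr 4
  rw [MultiBracket.contract_add_sub, h.riemann_eq hu,
    MultiBracket.contract_swap (fun i j k l ↦
      ∑ r, 𝒮.nablaHatLow 𝒮.ProjLow k r i p * 𝒮.nablaHat 𝒮.Proj l r j p),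
    MultiBracket.contract_sum_mul (fun k r i ↦ 𝒮.nablaHatLow 𝒮.ProjLow k r i p)
      (fun l r j ↦ 𝒮.nablaHat 𝒮.Proj l r j p),
    MultiBracket.contract_sum_mul (fun k r i ↦ 𝒮.nablaHatLow 𝒮.ProjLow k r i p)
      (fun l r j ↦ 𝒮.nablaHat 𝒮.Proj l r j p)]
  simp only [MultiBracket.Setting.sum_nablaHat_Proj h𝒮 hp,
    MultiBracket.Setting.sum_nablaHatLow_ProjLow h𝒮 hp, neg_mul_neg, h.sum_normalProjLow_mul hu,
    MultiBracket.contract_eq_sum, MultiBracket.Setting.Rbar_eq hp]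
  -- The second product arises from the first by exchanging `i` and `j`, so its two factors appear
  -- in the order opposite to that of the Gauss equation.
  rw [h.normalBil_symm hu (MultiBracket.covd _ _ d _ _)]
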